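/- Let $k$ be an integer with $12\nmid k$, let $R\in\mathbb{R}\setminus\{0\}$, and write $e(x)=e^{2\pi i x}$. Let $\eta$ be the Dedekind eta function and $v_\eta$ its multiplier, $\eta(Az)=v_\eta(A)(cz+d)^{1/2}\eta(z)$ (principal branch) for $A=\begin{pmatrix}a&b\\c&d\end{pmatrix}\in SL(2,\mathbb{Z})$. Put $v=v_\eta^{2k}$, let $\overline v$ be its complex conjugate, and set $\xi=v\begin{pmatrix}1&1\\0&1\end{pmatrix}=e^{\pi i k/6}$ and $\chi_k(d)=i^{k(d-1)}$. For $u\in\{v,\overline v\}$ let $\mathcal{M}(u,k,R)$ be the space of Maass waveforms of weight $k$ and multiplier $u$, that is, of all $C^2$ functions $f:\mathbb{H}\to\mathbb{C}$ such that $e^{-ik\operatorname{Arg}(cz+d)}f(Az)=u(A)f(z)$ for all $A\in SL(2,\mathbb{Z})$ and $z\in\mathbb{H}$ (with $\operatorname{Arg}\in(-\pi,\pi]$), $\Big(y^2\big(\tfrac{\partial^2}{\partial x^2}+\tfrac{\partial^2}{\partial y^2}\big)-iky\tfrac{\partial}{\partial x}+\tfrac14+R^2\Big)f=0$, and $\int_{SL(2,\mathbb{Z})\backslash\mathbb{H}}|f|^2\,\frac{dx\,dy}{y^2}<\infty$.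 With $W_{\kappa,\mu}$ the Whittaker $W$-function and $\alpha=k/12$, define for $n\in\mathbb{Z}$ and $z=x+iy\in\mathbb{H}$ $$\mathcal{W}_{n}(z)=\frac{1}{\sqrt{|n+\alpha|}}\,W_{\frac k2\operatorname{sgn}(n+\alpha),\,iR}\big(4\pi|n+\alpha|y\big)\,e\big((n+\alpha)x\big),\qquad \mathcal{W}^*_{n}(z)=\frac{1}{\sqrt{|n-\alpha|}}\,W_{\frac k2\operatorname{sgn}(n-\alpha),\,iR}\big(4\pi|n-\alpha|y\big)\,e\big((n-\alpha)x\big).$$ Let $m$ be a positive integer with $km\equiv-k\pmod{12}$. For functions $f,g:\mathbb{H}\to\mathbb{C}$ define the Hecke operators $$T_mf(z)=\frac1{\sqrt m}\sum_{\substack{ad=m\\ d>0}}\chi_k(d)\sum_{b=0}^{d-1}\xi^{-bd}f\Big(\frac{az+b}{d}\Big),\qquad T^{\overline v}_mg(z)=\frac1{\sqrt m}\sum_{\substack{ad=m\\ d>0}}\chi_k(d)\sum_{b=0}^{d-1}\overline{\xi}^{\,-bd}g\Big(\frac{az+b}{d}\Big).$$ Then: 1. $T_m$ maps $\mathcal{M}(v,k,R)$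 into $\mathcal{M}(\overline v,k,R)$, and $T^{\overline v}_m$ maps $\mathcal{M}(\overline v,k,R)$ into $\mathcal{M}(v,k,R)$. 2. If $f\in\mathcal{M}(v,k,R)$ has the (absolutely convergent) Fourier expansion $f=\sum_{n\in\mathbb{Z}}c(n)\mathcal{W}_n$ on $\mathbb{H}$, then $T_mf=\sum_{n\in\mathbb{Z}}d(n)\mathcal{W}^*_n$ on $\mathbb{H}$ (absolutely convergent), where $$d(n)=(-1)^k\sum_{0<a\,\mid\,\left(m,\;n-\frac{k(m+1)}{12}\right)}\chi_k(a)\;c\!\left(\frac{mn}{a^2}-\frac{k(m+a^2)}{12a^2}\right).$$ 3. If $g\in\mathcal{M}(\overline v,k,R)$ has the (absolutely convergent) Fourier expansion $g=\sum_{n\in\mathbb{Z}}a(n)\mathcal{W}^*_n$ on $\mathbb{H}$, then $T^{\overline v}_mg=\sum_{n\in\mathbb{Z}}b(n)\mathcal{W}_n$ on $\mathbb{H}$ (absolutely convergent), where $$b(n)=(-1)^k\sum_{0<l\,\mid\,\left(m,\;n+\frac{k(m+1)}{12}\right)}\chi_k(l)\;a\!\left(\frac{mn}{l^2}+\frac{k(m+l^2)}{12l^2}\right).$$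 Here $(\cdot,\cdot)$ is the greatest common divisor, with $(m,0)=m$, and coefficients at non-integral arguments are read as $0$. -/

import Mathlib

open scoped UpperHalfPlane MatrixGroups ComplexConjugate

noncomputable section

namespace MaassHecke

/-! ### The eta multiplier system -/

/-- The eta multiplier `v_η(A)`, determined by `η(Az) = v_η(A) (cz + d)^{1/2} η(z)` with the
principal branch of the square root. The quotient does not depend on `z` (`η` has no zeros on the
upper half-plane) and is read off at `z = i`. -/
def etaMultiplier (A : SL(2, ℤ)) : ℂ :=
  ModularForm.eta ((A • UpperHalfPlane.I : ℍ) : ℂ) /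
    (((A 1 0 : ℂ) * Complex.I + (A 1 1 : ℂ)) ^ (1 / 2 : ℂ) * ModularForm.eta Complex.I)

/-- The multiplier system `v = v_η^{2k}`. -/
def mult (k : ℤ) (A : SL(2, ℤ)) : ℂ := etaMultiplier A ^ (2 * k)

/-- The conjugate multiplier system `v̄`. -/
def multConj (k : ℤ) (A : SL(2, ℤ)) : ℂ := conj (mult k A)

/-- `ξ = e^{πik/6}`, the value of `v` at the translation `z ↦ z + 1`. -/
def xi (k : ℤ) : ℂ := Complex.exp (Real.pi * Complex.I * k / 6)

/-- `χ_k(d) = i^{k(d-1)}`. -/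
def chi (k : ℤ) (d : ℕ) : ℂ := Complex.I ^ (k * ((d : ℤ) - 1))

/-! ### Maass waveforms -/

/-- The automorphy factor `j_A(z; k) = e^{ik Arg(cz + d)}`. -/
def autFactor (k : ℤ) (A : SL(2, ℤ)) (z : ℍ) : ℂ :=
  Complex.exp (Complex.I * k * Complex.arg ((A 1 0 : ℂ) * z + (A 1 1 : ℂ)))

/-- The weight `k` slash action `j_A(z; k)⁻¹ f(Az)`. -/
def slash (k : ℤ) (A : SL(2, ℤ)) (f : ℍ → ℂ) (z : ℍ) : ℂ :=
  (autFactor k A z)⁻¹ * f (A • z)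

/-- The weight `k` Laplacian `y²(∂²/∂x² + ∂²/∂y²) - iky ∂/∂x`. The function `f ∘ ofComplex` is `f`
regarded as a function on the open subset `ℍ` of `ℂ`. -/
def weightLaplacian (k : ℤ) (f : ℍ → ℂ) (z : ℍ) : ℂ :=
  (z.im : ℂ) ^ 2 * Laplacian.laplacian (f ∘ UpperHalfPlane.ofComplex) (z : ℂ) -
    Complex.I * k * z.im * fderiv ℝ (f ∘ UpperHalfPlane.ofComplex) (z : ℂ) 1

/-- `f` is a Maass waveform for the multiplier system `v` of weight `k`, with Laplace eigenvalue
`1/4 + R²`. The measure on `ℍ` is `dx dy / y²`, and `ModularGroup.fd` is the standard fundamental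
domain of the modular group. -/
structure IsMaassWaveform (v : SL(2, ℤ) → ℂ) (k : ℤ) (R : ℝ) (f : ℍ → ℂ) : Prop where
  contDiffOn : ContDiffOn ℝ 2 (f ∘ UpperHalfPlane.ofComplex) {z : ℂ | 0 < z.im}
  slash_eq : ∀ (A : SL(2, ℤ)) (z : ℍ), slash k A f z = v A * f z
  eigen : ∀ z : ℍ, weightLaplacian k f z + ((1 / 4 + R ^ 2 : ℝ) : ℂ) * f z = 0
  sq_integrable : MeasureTheory.IntegrableOn (fun z : ℍ => ‖f z‖ ^ 2) ModularGroup.fd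

/-- The space of Maass waveforms with multiplier system `v`, weight `k`, spectral parameter `R`. -/
def maassSpace (v : SL(2, ℤ) → ℂ) (k : ℤ) (R : ℝ) : Set (ℍ → ℂ) :=
  {f | IsMaassWaveform v k R f}

/-! ### Whittaker functions and the two Fourier bases -/

/-- Kummer's function `Φ(a, c; x) = ∑ (a)_n / (c)_n · xⁿ / n!`, for `c ≠ 0, -1, -2, …`. -/
def kummer (a c x : ℂ) : ℂ := Complex.Gamma c * Complex.regularizedHGFun {a} {c} x

/-- The Whittaker function `M_{κ,μ}(x)`, for `x > 0`. -/
def whittakerM (κ μ : ℂ) (x : ℝ) : ℂ :=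
  Complex.exp (-x / 2) * (x : ℂ) ^ (1 / 2 + μ) * kummer (1 / 2 + μ - κ) (1 + 2 * μ) x

/-- The Whittaker function `W_{κ,μ}(x)`, for `x > 0` and `2μ` not an integer. -/
def whittakerW (κ μ : ℂ) (x : ℝ) : ℂ :=
  Complex.Gamma (-2 * μ) / Complex.Gamma (1 / 2 - μ - κ) * whittakerM κ μ x +
    Complex.Gamma (2 * μ) / Complex.Gamma (1 / 2 + μ - κ) * whittakerM κ (-μ) x

/-- `|ν|^{-1/2} W_{(k/2) sgn ν, iR}(4π|ν|y) e(νx)`. -/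
def whittakerTerm (k : ℤ) (R ν : ℝ) (z : ℍ) : ℂ :=
  ((1 / Real.sqrt |ν| : ℝ) : ℂ) *
    whittakerW ((k / 2 * Real.sign ν : ℝ) : ℂ) (Complex.I * R) (4 * Real.pi * |ν| * z.im) *
    Complex.exp (2 * Real.pi * Complex.I * (ν * z.re : ℝ))

/-- The basis function `𝒲_{n,k,R}`, of frequency `n + k/12`. -/
def calW (n k : ℤ) (R : ℝ) : ℍ → ℂ := whittakerTerm k R (n + k / 12)

/-- The basis function `𝒲*_{n,k,R}`, of frequency `n - k/12`. -/
def calWstar (n k : ℤ) (R : ℝ) : ℍ → ℂ := whittakerTerm k R (n - k / 12)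

/-- `c(x)` for rational `x`, with the convention `c(x) = 0` if `x` is not an integer. -/
def coeffAt (c : ℤ → ℂ) (x : ℚ) : ℂ := if x.den = 1 then c x.num else 0

/-! ### The Hecke operators -/

/-- `f ↦ m^{-1/2} ∑_{ad = m, d > 0} χ_k(d) ∑_{b mod d} ζ^{-bd} f((az + b)/d)`. -/
def heckeSum (ζ : ℂ) (k : ℤ) (m : ℕ) : (ℍ → ℂ) →ₗ[ℂ] (ℍ → ℂ) where
  toFun f z := ((1 / Real.sqrt m : ℝ) : ℂ) * ∑ p ∈ m.divisorsAntidiagonal,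
    chi k p.2 * ∑ b ∈ Finset.range p.2,
      ζ ^ (-((b : ℤ) * p.2)) * f (UpperHalfPlane.ofComplex ((p.1 * z + b) / p.2))
  map_add' f g := by
    funext z
    simp only [Pi.add_apply, mul_add, Finset.sum_add_distrib]
  map_smul' r f := by
    funext z
    simp only [Pi.smul_apply, smul_eq_mul, RingHom.id_apply, Finset.mul_sum]
    refine Finset.sum_congr rfl fun p _ => Finset.sum_congr rfl fun b _ => ?_
    ring

/-- The operator `T_m`. -/
def heckeT (k : ℤ) (m : ℕ) : (ℍ → ℂ) →ₗ[ℂ] (ℍ → ℂ) := heckeSum (xi k) k m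

/-- The operator `T^{v̄}_m`, with `ξ` replaced by `ξ̄`. -/
def heckeTConj (k : ℤ) (m : ℕ) : (ℍ → ℂ) →ₗ[ℂ] (ℍ → ℂ) := heckeSum (conj (xi k)) k m

/-- The Fourier coefficients of `T_m f`, in terms of those of `f`. -/
def coeffT (k : ℤ) (m : ℕ) (c : ℤ → ℂ) (n : ℤ) : ℂ :=
  (-1) ^ k * ∑ a ∈ (Int.gcd m (n - k * (m + 1) / 12)).divisors,
    chi k a * coeffAt c ((m * n : ℚ) / a ^ 2 - k * (m + a ^ 2) / (12 * a ^ 2))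

/-- The Fourier coefficients of `T^{v̄}_m g`, in terms of those of `g`. -/
def coeffTConj (k : ℤ) (m : ℕ) (c : ℤ → ℂ) (n : ℤ) : ℂ :=
  (-1) ^ k * ∑ a ∈ (Int.gcd m (n + k * (m + 1) / 12)).divisors,
    chi k a * coeffAt c ((m * n : ℚ) / a ^ 2 + k * (m + a ^ 2) / (12 * a ^ 2))

end MaassHecke

end

noncomputable section

namespace MaassHecke

/-! ### The character of order twelve of the modular group -/

/-! Squaring `η` removes the branch of the square root: `η²` has weight one and a genuine character
of `SL(2, ℤ)` of order twelve, and `v` is the `k`-th power of that character (`mult_eq`). Its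
exponent modulo 12 is a polynomial in the entries, so it makes sense for every integral matrix. Its
`j`-th power still transforms by the character under the generators whenever `j (det - 1) ≡ 0`
modulo 12.

The hypothesis `km ≡ -k` says exactly that this congruence holds for `j = ±k` and determinant `-m`,
hence for `M ε` with `det M = m` and `ε = diag(1, -1)`. Weighting `f | M` by the inverse of the
character at `M ε` gives a function of `M` constant on orbits `SL(2, ℤ) M`. Right multiplication by
`SL(2, ℤ)` permutes these orbits, and conjugation by `ε` inverts `S` and `T`, so the sum over orbits
transforms by the conjugate character (`slash_orbitSum`). On triangular representatives the weight
is `χ_k(d) ξ^{-bd}` up to the factor `(-1)^k` (`chi_mul_eq_heckeWeight`), so `T_m` is a multiple of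
this sum. The Laplace equation is invariant under the affine maps `z ↦ (az + b)/d`, and square
integrability survives because they send the fundamental domain into a Siegel set.

For the Fourier expansion, fix `ad = m`. The sum over `b` is a character sum modulo `d`, which
selects one residue class of frequencies; the surviving terms are reindexed (`hasSum_inner`) and
then summed over `a`. Everything is done for `j = ±k` at once, so both operators are covered. -/

/-- A polynomial in the entries of `A ∈ SL(2, ℤ)` whose class modulo 12 is the image of `A` in the
abelianization `ℤ/12` of `SL(2, ℤ)`. -/
def abPoly {R : Type*} [CommRing R] (a b c d : R) : R :=
  (1 - c ^ 2) * (b * d + 3 * (c - 1) * d + c + 3) + c * (a + d - 3)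

lemma twelve_dvd_iff (n : ℤ) : 12 ∣ n ↔ ((n : ZMod 3) = 0 ∧ (n : ZMod 4) = 0) := by
  rw [ZMod.intCast_zmod_eq_zero_iff_dvd, ZMod.intCast_zmod_eq_zero_iff_dvd]
  omega

set_option maxRecDepth 100000 in
-- The four parts describe `M ↦ TM`, `SM`, `MT⁻¹`, `MS⁻¹`. The factor `j` weakens the determinant
-- condition to what holds for the Hecke matrices. Modulo 3, and below modulo 4, this is a finite
-- check; the two together give the claim modulo 12.
lemma abPoly_zmod_three : ∀ j a b c d : ZMod 3, j * (a * d - b * c - 1) = 0 →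
    j * (abPoly (a + c) (b + d) c d - abPoly a b c d - 1) = 0 ∧
    j * (abPoly (-c) (-d) a b - abPoly a b c d + 3) = 0 ∧
    j * (abPoly a (b - a) c (d - c) - abPoly a b c d + 1) = 0 ∧
    j * (abPoly (-b) a (-d) c - abPoly a b c d - 3) = 0 := by
  unfold abPoly
  decide

set_option maxRecDepth 100000 in
lemma abPoly_zmod_four : ∀ j a b c d : ZMod 4, j * (a * d - b * c - 1) = 0 →
    j * (abPoly (a + c) (b + d) c d - abPoly a b c d - 1) = 0 ∧
    j * (abPoly (-c) (-d) a b - abPoly a b c d + 3) = 0 ∧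
    j * (abPoly a (b - a) c (d - c) - abPoly a b c d + 1) = 0 ∧
    j * (abPoly (-b) a (-d) c - abPoly a b c d - 3) = 0 := by
  unfold abPoly
  decide

lemma abPoly_dvd {j a b c d : ℤ} (h : 12 ∣ j * (a * d - b * c - 1)) :
    12 ∣ j * (abPoly (a + c) (b + d) c d - abPoly a b c d - 1) ∧
    12 ∣ j * (abPoly (-c) (-d) a b - abPoly a b c d + 3) ∧
    12 ∣ j * (abPoly a (b - a) c (d - c) - abPoly a b c d + 1) ∧
    12 ∣ j * (abPoly (-b) a (-d) c - abPoly a b c d - 3) := by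
  rw [twelve_dvd_iff] at h
  have h3 := abPoly_zmod_three j a b c d (by exact_mod_cast h.1)
  have h4 := abPoly_zmod_four j a b c d (by exact_mod_cast h.2)
  simp only [twelve_dvd_iff]
  simp only [abPoly] at *
  push_cast
  exact ⟨⟨h3.1, h4.1⟩, ⟨h3.2.1, h4.2.1⟩, ⟨h3.2.2.1, h4.2.2.1⟩, ⟨h3.2.2.2, h4.2.2.2⟩⟩

/-- The additive character `n ↦ e(n/12)` of `ℤ`. -/
def e12 (n : ℤ) : ℂ := Complex.exp (2 * Real.pi * Complex.I * n / 12)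

lemma e12_add (m n : ℤ) : e12 (m + n) = e12 m * e12 n := by
  rw [e12, e12, e12, ← Complex.exp_add]
  push_cast
  ring_nf

lemma e12_zero : e12 0 = 1 := by simp [e12]

lemma e12_ne_zero (n : ℤ) : e12 n ≠ 0 := Complex.exp_ne_zero _

lemma e12_neg (n : ℤ) : e12 (-n) = (e12 n)⁻¹ := by
  rw [e12, e12, ← Complex.exp_neg]
  push_cast
  ring_nf

lemma e12_mul (m n : ℤ) : e12 (m * n) = e12 m ^ n := by
  rw [e12, e12, ← Complex.exp_int_mul]
  push_cast
  ring_nf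

lemma norm_e12 (n : ℤ) : ‖e12 n‖ = 1 := by
  rw [e12, show 2 * Real.pi * Complex.I * n / 12 = ((2 * Real.pi * n / 12 : ℝ) : ℂ) * Complex.I by
    push_cast; ring, Complex.norm_exp_ofReal_mul_I]

lemma conj_e12 (n : ℤ) : conj (e12 n) = e12 (-n) := by
  rw [e12, e12, ← Complex.exp_conj]
  simp [map_ofNat]

lemma e12_eq_one_of_dvd {n : ℤ} (h : 12 ∣ n) : e12 n = 1 := by
  obtain ⟨q, rfl⟩ := h
  rw [e12, Complex.exp_eq_one_iff]
  exact ⟨q, by push_cast; ring⟩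

lemma e12_congr {m n : ℤ} (h : 12 ∣ m - n) : e12 m = e12 n := by
  rw [← sub_add_cancel m n, e12_add, e12_eq_one_of_dvd h, one_mul]

lemma e12_three : e12 3 = Complex.I := by
  rw [e12, show 2 * Real.pi * Complex.I * ((3 : ℤ) : ℂ) / 12 = Real.pi / 2 * Complex.I by
    push_cast; ring, Complex.exp_pi_div_two_mul_I]

lemma xi_eq (k : ℤ) : xi k = e12 k := by
  rw [xi, e12]
  congr 1
  ring

/-- The extension of the `j`-th power of the character of order twelve of `SL(2, ℤ)` to all integral
matrices. It is multiplicative on those with `j (det M - 1) ≡ 0` modulo 12. -/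
def matChar (j : ℤ) (M : Matrix (Fin 2) (Fin 2) ℤ) : ℂ :=
  e12 (j * abPoly (M 0 0) (M 0 1) (M 1 0) (M 1 1))

lemma matChar_ne_zero (j : ℤ) (M : Matrix (Fin 2) (Fin 2) ℤ) : matChar j M ≠ 0 := e12_ne_zero _

lemma matChar_T_mul {j : ℤ} {M : Matrix (Fin 2) (Fin 2) ℤ} (h : 12 ∣ j * (M.det - 1)) :
    matChar j (ModularGroup.T * M) = e12 j * matChar j M := by
  rw [Matrix.det_fin_two] at h
  rw [matChar, matChar, ← e12_add]
  apply e12_congr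
  convert! (abPoly_dvd h).1 using 1
  simp [ModularGroup.T, Matrix.mul_apply, Fin.sum_univ_two]
  ring

lemma matChar_S_mul {j : ℤ} {M : Matrix (Fin 2) (Fin 2) ℤ} (h : 12 ∣ j * (M.det - 1)) :
    matChar j (ModularGroup.S * M) = e12 (-3 * j) * matChar j M := by
  rw [Matrix.det_fin_two] at h
  rw [matChar, matChar, ← e12_add]
  apply e12_congr
  convert! (abPoly_dvd h).2.1 using 1
  simp [ModularGroup.S, Matrix.mul_apply, Fin.sum_univ_two]
  ring

lemma matChar_mul_T_inv {j : ℤ} {M : Matrix (Fin 2) (Fin 2) ℤ} (h : 12 ∣ j * (M.det - 1)) :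
    matChar j (M * !![1, -1; 0, 1]) = e12 (-j) * matChar j M := by
  rw [Matrix.det_fin_two] at h
  rw [matChar, matChar, ← e12_add]
  apply e12_congr
  convert! (abPoly_dvd h).2.2.1 using 1
  simp [Matrix.mul_apply, Fin.sum_univ_two, ← sub_eq_neg_add]
  ring

lemma matChar_mul_S_inv {j : ℤ} {M : Matrix (Fin 2) (Fin 2) ℤ} (h : 12 ∣ j * (M.det - 1)) :
    matChar j (M * !![0, 1; -1, 0]) = e12 (3 * j) * matChar j M := by
  rw [Matrix.det_fin_two] at h
  rw [matChar, matChar, ← e12_add]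
  apply e12_congr
  convert! (abPoly_dvd h).2.2.2 using 1
  simp [Matrix.mul_apply, Fin.sum_univ_two]
  ring

lemma matChar_one (j : ℤ) : matChar j (1 : Matrix (Fin 2) (Fin 2) ℤ) = 1 := by
  simp [matChar, abPoly, e12_zero]

lemma norm_matChar (j : ℤ) (M : Matrix (Fin 2) (Fin 2) ℤ) : ‖matChar j M‖ = 1 := norm_e12 _

lemma matChar_eq_zpow (j : ℤ) (M : Matrix (Fin 2) (Fin 2) ℤ) :
    matChar j M = matChar 1 M ^ j := by
  rw [matChar, matChar, one_mul, mul_comm, e12_mul]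

lemma conj_matChar (j : ℤ) (M : Matrix (Fin 2) (Fin 2) ℤ) :
    conj (matChar j M) = matChar (-j) M := by
  rw [matChar, matChar, conj_e12, neg_mul]

lemma twelve_dvd_of_SL (j : ℤ) (A : SL(2, ℤ)) : 12 ∣ j * (A.1.det - 1) := by
  simp

/-- Induction on a word for `A` in `S` and `T`. The statement is kept for all `M` during the
induction, since the product and inverse cases apply it to `B M` and `A⁻¹ M`. -/
lemma matChar_SL_mul {j : ℤ} (A : SL(2, ℤ)) {M : Matrix (Fin 2) (Fin 2) ℤ}
    (h : 12 ∣ j * (M.det - 1)) :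
    matChar j (A.1 * M) = matChar j A.1 * matChar j M := by
  have key : ∀ A : SL(2, ℤ), ∀ M : Matrix (Fin 2) (Fin 2) ℤ, 12 ∣ j * (M.det - 1) →
      matChar j (A.1 * M) = matChar j A.1 * matChar j M := by
    intro A
    have hA : A ∈ Subgroup.closure {ModularGroup.S, ModularGroup.T} := by
      rw [SpecialLinearGroup.SL2Z_generators]; trivial
    induction hA using Subgroup.closure_induction with
    | mem A hA =>
      intro M hM
      have h1 : 12 ∣ j * ((1 : Matrix (Fin 2) (Fin 2) ℤ).det - 1) := by simp
      rcases hA with rfl | rfl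
      · rw [matChar_S_mul hM, ← mul_one ModularGroup.S.1, matChar_S_mul h1, matChar_one, mul_one]
      · rw [matChar_T_mul hM, ← mul_one ModularGroup.T.1, matChar_T_mul h1, matChar_one, mul_one]
    | one => intro M _; simp [matChar_one]
    | mul A B _ _ hA hB =>
      intro M hM
      have hBM : 12 ∣ j * ((B.1 * M).det - 1) := by simpa using hM
      rw [Matrix.SpecialLinearGroup.coe_mul, mul_assoc, hA _ hBM, hB _ hM,
        hA _ (twelve_dvd_of_SL j B), mul_assoc]
    | inv A _ hA =>
      intro M hM
      have h1 := hA (A⁻¹.1 * M) (by rwa [Matrix.det_mul, A⁻¹.2, one_mul])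
      have h2 := hA A⁻¹.1 (twelve_dvd_of_SL j _)
      rw [← mul_assoc, ← Matrix.SpecialLinearGroup.coe_mul, mul_inv_cancel,
        Matrix.SpecialLinearGroup.coe_one, one_mul] at h1
      rw [← Matrix.SpecialLinearGroup.coe_mul, mul_inv_cancel,
        Matrix.SpecialLinearGroup.coe_one, matChar_one] at h2
      rw [h1, ← mul_assoc, mul_comm (matChar j _) (matChar j A.1), ← h2, one_mul]
  exact key A M h

lemma matChar_SL_mul_SL (j : ℤ) (A B : SL(2, ℤ)) :
    matChar j (A * B).1 = matChar j A.1 * matChar j B.1 :=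
  matChar_SL_mul A (twelve_dvd_of_SL j B)

lemma matChar_SL_inv (j : ℤ) (A : SL(2, ℤ)) : matChar j A⁻¹.1 = (matChar j A.1)⁻¹ := by
  refine eq_inv_of_mul_eq_one_left ?_
  rw [← matChar_SL_mul_SL, inv_mul_cancel, Matrix.SpecialLinearGroup.coe_one, matChar_one]

/-! ### The square of the eta function -/

open UpperHalfPlane in
lemma denom_mul_SL (A B : SL(2, ℤ)) (z : ℍ) :
    denom ((A * B : SL(2, ℤ)) : GL (Fin 2) ℝ) z =
      denom (A : GL (Fin 2) ℝ) (B • z : ℍ) * denom (B : GL (Fin 2) ℝ) z := by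
  rw [map_mul, map_mul, denom_cocycle _ _ z.im_ne_zero, ModularGroup.sl_moeb, coe_smul_of_det_pos]
  simp

open UpperHalfPlane in
lemma eta_S_sq (z : ℍ) :
    ModularForm.eta ((ModularGroup.S • z : ℍ) : ℂ) ^ 2 =
      e12 (-3) * z * ModularForm.eta z ^ 2 := by
  have h := ModularForm.eta_comp_eq_csqrt_I_inv z.2
  have hs : ((ModularGroup.S • z : ℍ) : ℂ) = -1 / z := by
    rw [modular_S_smul, neg_div, one_div]
    simp
  have hsq : ∀ w : ℂ, w ≠ 0 → Complex.sqrt w ^ 2 = w := by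
    intro w hw
    rw [Complex.sqrt, ← Complex.cpow_nat_mul]
    simp
  simp only [Function.comp_apply, Pi.smul_apply, Pi.mul_apply, smul_eq_mul] at h
  rw [hs, h, mul_pow, inv_pow, hsq _ Complex.I_ne_zero, mul_pow, hsq _ z.ne_zero, e12_neg,
    e12_three]
  ring

lemma eta_add_one_sq (z : ℂ) : ModularForm.eta (z + 1) ^ 2 = e12 1 * ModularForm.eta z ^ 2 := by
  have hq : ∀ n, ModularForm.eta_q n (z + 1) = ModularForm.eta_q n z := by
    intro n
    rw [ModularForm.eta_q_eq_pow, ModularForm.eta_q_eq_pow, mul_add, Complex.exp_add, mul_one,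
      Complex.exp_two_pi_mul_I, mul_one]
  have h24 : Function.Periodic.qParam 24 (z + 1) ^ 2 =
      e12 1 * Function.Periodic.qParam 24 z ^ 2 := by
    rw [Function.Periodic.qParam, Function.Periodic.qParam, e12, ← Complex.exp_nat_mul,
      ← Complex.exp_nat_mul, ← Complex.exp_add]
    congr 1
    push_cast
    ring
  rw [ModularForm.eta, ModularForm.eta, mul_pow, mul_pow, h24, mul_assoc]
  simp_rw [hq]

open UpperHalfPlane in
-- Both sides are cocycles in `A`, so the formula follows from its cases `S` and `T`.
lemma eta_smul_sq (A : SL(2, ℤ)) (z : ℍ) :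
    ModularForm.eta ((A • z : ℍ) : ℂ) ^ 2 =
      matChar 1 A.1 * denom (A : GL (Fin 2) ℝ) z * ModularForm.eta z ^ 2 := by
  have hA : A ∈ Subgroup.closure {ModularGroup.S, ModularGroup.T} := by
    rw [SpecialLinearGroup.SL2Z_generators]; trivial
  induction hA using Subgroup.closure_induction generalizing z with
  | mem A hA =>
    have h1 : 12 ∣ (1 : ℤ) * ((1 : Matrix (Fin 2) (Fin 2) ℤ).det - 1) := by simp
    rcases hA with rfl | rfl
    · rw [eta_S_sq, ← mul_one ModularGroup.S.1, matChar_S_mul h1, matChar_one, ModularGroup.denom_S]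
      simp
    · rw [← mul_one ModularGroup.T.1, matChar_T_mul h1, matChar_one, modular_T_smul,
        coe_vadd, add_comm, ModularGroup.denom_apply]
      simp [ModularGroup.T, eta_add_one_sq]
  | one => simp [matChar_one]
  | mul A B _ _ hA hB =>
    rw [mul_smul, hA, hB, denom_mul_SL, matChar_SL_mul_SL]
    ring
  | inv A _ hA =>
    have h1 := hA (A⁻¹ • z)
    have h2 := denom_mul_SL A A⁻¹ z
    rw [mul_inv_cancel, map_one, map_one, denom_one] at h2
    rw [smul_inv_smul] at h1
    rw [h1, matChar_SL_inv]
    have h3 := matChar_ne_zero 1 A.1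
    field_simp
    linear_combination (ModularForm.eta ((A⁻¹ • z : ℍ) : ℂ) ^ 2) * h2

open UpperHalfPlane in
lemma mult_eq (k : ℤ) (A : SL(2, ℤ)) : mult k A = matChar k A.1 := by
  have hI : ModularForm.eta Complex.I ≠ 0 := ModularForm.eta_ne_zero (by simp)
  have hd : denom (A : GL (Fin 2) ℝ) I ≠ 0 := denom_ne_zero _ _
  have hd' : denom (A : GL (Fin 2) ℝ) I = (A 1 0 : ℂ) * Complex.I + (A 1 1 : ℂ) := by
    simp [denom]
  have h := eta_smul_sq A I
  rw [mult, zpow_mul, matChar_eq_zpow]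
  congr 1
  -- Squaring turns `(ci + d)^{1/2}` into `ci + d`, whatever the branch.
  rw [etaMultiplier, zpow_ofNat, div_pow, mul_pow, h, ← hd', ← Complex.cpow_nat_mul]
  rw [coe_I] at *
  simp
  field_simp

lemma multConj_eq (k : ℤ) (A : SL(2, ℤ)) : multConj k A = matChar (-k) A.1 := by
  rw [multConj, mult_eq, conj_matChar]

/-! ### The weight `k` action of `GL(2, ℝ)` -/

/-- The automorphy factor `((cz + d) / |cz + d|)^k`. -/
def phase (k : ℤ) (g : GL (Fin 2) ℝ) (z : ℍ) : ℂ :=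
  (UpperHalfPlane.denom g z / ‖UpperHalfPlane.denom g z‖) ^ k

/-- As `k` is an integer, the exponential of the argument is an integral power of `w / |w|`. This
form is an exact cocycle and extends to real matrices. -/
lemma autFactor_eq (k : ℤ) (A : SL(2, ℤ)) (z : ℍ) :
    autFactor k A z = phase k (A : GL (Fin 2) ℝ) z := by
  have h : UpperHalfPlane.denom (A : GL (Fin 2) ℝ) z = (A 1 0 : ℂ) * z + (A 1 1 : ℂ) := by
    simp [UpperHalfPlane.denom]
  rw [autFactor, phase, ← h, mul_comm Complex.I, mul_assoc, Complex.exp_int_mul]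
  congr 1
  rw [eq_div_iff (by simp), mul_comm, mul_comm Complex.I, Complex.norm_mul_exp_arg_mul_I]

lemma phase_mul (k : ℤ) (g h : GL (Fin 2) ℝ) (hh : 0 < h.det.val) (z : ℍ) :
    phase k (g * h) z = phase k g (h • z) * phase k h z := by
  rw [phase, phase, phase, UpperHalfPlane.denom_cocycle _ _ z.im_ne_zero,
    ← UpperHalfPlane.coe_smul_of_det_pos hh, ← mul_zpow, norm_mul, div_mul_div_comm,
    Complex.ofReal_mul]

/-- The weight `k` slash action of `GL(2, ℝ)`. -/
def glSlash (k : ℤ) (g : GL (Fin 2) ℝ) (f : ℍ → ℂ) (z : ℍ) : ℂ :=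
  (phase k g z)⁻¹ * f (g • z)

lemma slash_eq_glSlash (k : ℤ) (A : SL(2, ℤ)) (f : ℍ → ℂ) :
    slash k A f = glSlash k (A : GL (Fin 2) ℝ) f := by
  ext z
  rw [slash, glSlash, autFactor_eq, ModularGroup.sl_moeb]

lemma glSlash_mul (k : ℤ) (g h : GL (Fin 2) ℝ) (hh : 0 < h.det.val) (f : ℍ → ℂ) :
    glSlash k (g * h) f = glSlash k h (glSlash k g f) := by
  ext z
  rw [glSlash, glSlash, glSlash, phase_mul _ _ _ hh, mul_inv, mul_smul]
  ring

lemma glSlash_const_mul (k : ℤ) (g : GL (Fin 2) ℝ) (r : ℂ) (f : ℍ → ℂ) :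
    glSlash k g (fun z => r * f z) = fun z => r * glSlash k g f z := by
  ext z
  rw [glSlash, glSlash]
  ring

lemma slash_mul (k : ℤ) (A B : SL(2, ℤ)) (f : ℍ → ℂ) :
    slash k (A * B) f = slash k B (slash k A f) := by
  rw [slash_eq_glSlash, slash_eq_glSlash, slash_eq_glSlash, map_mul, map_mul, glSlash_mul]
  simp

lemma slash_const_mul (k : ℤ) (A : SL(2, ℤ)) (r : ℂ) (f : ℍ → ℂ) :
    slash k A (fun z => r * f z) = fun z => r * slash k A f z := by
  rw [slash_eq_glSlash, slash_eq_glSlash, glSlash_const_mul]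

lemma slash_one (k : ℤ) (f : ℍ → ℂ) : slash k 1 f = f := by
  ext z
  simp [slash, autFactor]

/-- It suffices to check the transformation law under the generators `S` and `T`. -/
lemma slash_eq_matChar_of_generators {k j : ℤ} {f : ℍ → ℂ}
    (hS : slash k ModularGroup.S f = fun z => matChar j ModularGroup.S.1 * f z)
    (hT : slash k ModularGroup.T f = fun z => matChar j ModularGroup.T.1 * f z) (A : SL(2, ℤ)) :
    slash k A f = fun z => matChar j A.1 * f z := by
  have hA : A ∈ Subgroup.closure {ModularGroup.S, ModularGroup.T} := by
    rw [SpecialLinearGroup.SL2Z_generators]; trivial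
  induction hA using Subgroup.closure_induction with
  | mem A hA =>
    rcases hA with rfl | rfl
    exacts [hS, hT]
  | one => simp [matChar_one, slash_one]
  | mul A B _ _ hA hB =>
    rw [slash_mul, hA, slash_const_mul, hB, matChar_SL_mul_SL]
    ext z
    ring
  | inv A _ hA =>
    have h := slash_mul k A A⁻¹ f
    rw [mul_inv_cancel, slash_one, hA, slash_const_mul] at h
    ext z
    have h3 := matChar_ne_zero j A.1
    rw [matChar_SL_inv]
    nth_rw 2 [h]
    field_simp

open FixedDetMatrices

/-! ### Integral matrices of determinant `m` modulo `SL(2, ℤ)` -/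

lemma exists_reduce_eq_smul {m : ℤ} (M : FixedDetMatrix (Fin 2) ℤ m) :
    ∃ A : SL(2, ℤ), reduce M = A • M := by
  induction M using reduce_rec with
  | base M h =>
    by_cases ha : 0 < M.1 0 0
    · exact ⟨_, reduce_of_pos h ha⟩
    · exact ⟨_, by rw [reduce_of_not_pos h ha, ← mul_smul, ← mul_smul]⟩
  | step M h ih =>
    obtain ⟨A, hA⟩ := ih
    exact ⟨_, by rw [← reduce_reduceStep h, hA, reduceStep, ← mul_smul, ← mul_smul]⟩

lemma diag_mul_of_mem_reps {m : ℤ} {M : FixedDetMatrix (Fin 2) ℤ m} (hM : M ∈ reps m) :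
    M.1 0 0 * M.1 1 1 = m := by
  have := M.2
  rwa [Matrix.det_fin_two, hM.1, mul_zero, sub_zero] at this

lemma diag_pos_of_mem_reps {m : ℤ} (hm : 0 < m) {M : FixedDetMatrix (Fin 2) ℤ m}
    (hM : M ∈ reps m) : 0 < M.1 1 1 :=
  pos_of_mul_pos_right (by rwa [diag_mul_of_mem_reps hM]) hM.2.1.le

/-- Two representatives in the same orbit are equal. -/
lemma eq_of_mem_reps {m : ℤ} (hm : 0 < m) {M N : FixedDetMatrix (Fin 2) ℤ m} (hM : M ∈ reps m)
    (hN : N ∈ reps m) {A : SL(2, ℤ)} (h : M = A • N) : M = N := by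
  have hMd := diag_pos_of_mem_reps hm hM
  have hNd := diag_pos_of_mem_reps hm hN
  obtain ⟨hM0, hMa, hMb, hMbd⟩ := hM
  obtain ⟨hN0, hNa, hNb, hNbd⟩ := hN
  have hdet := A.2
  rw [abs_of_nonneg hMb, abs_of_pos hMd] at hMbd
  rw [abs_of_nonneg hNb, abs_of_pos hNd] at hNbd
  rw [Matrix.det_fin_two] at hdet
  have e : ∀ i j, M.1 i j = A.1 i 0 * N.1 0 j + A.1 i 1 * N.1 1 j := by
    intro i j
    rw [h, smul_coe, Matrix.mul_apply, Fin.sum_univ_two]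
  have e00 := e 0 0
  have e01 := e 0 1
  have e10 := e 1 0
  have e11 := e 1 1
  rw [hN0, mul_zero, add_zero] at e00 e10
  have hc : A.1 1 0 = 0 := by
    rw [hM0] at e10
    exact (mul_eq_zero.mp e10.symm).resolve_right hNa.ne'
  rw [hc, mul_zero, sub_zero] at hdet
  have hα : 0 < A.1 0 0 := by
    rw [e00] at hMa
    exact pos_of_mul_pos_left hMa hNa.le
  have h1 : A.1 0 0 = 1 ∧ A.1 1 1 = 1 := by
    rcases Int.mul_eq_one_iff_eq_one_or_neg_one.mp hdet with h | h
    · exact h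
    · omega
  rw [hc, h1.2, zero_mul, zero_add, one_mul] at e11
  rw [h1.1, one_mul] at e00 e01
  -- `A` is now unipotent upper triangular, so the upper right entries differ by a multiple of the
  -- common `d`, while both lie in `[0, d)`.
  have hβ : A.1 0 1 = 0 := by
    by_contra hne
    rcases lt_or_gt_of_ne hne with hlt | hgt
    · nlinarith
    · nlinarith
  rw [hβ, zero_mul, add_zero] at e01
  ext i j
  fin_cases i <;> fin_cases j
  · exact e00
  · exact e01
  · exact hM0.trans hN0.symm
  · exact e11

/-- Right multiplication by an element of `SL(2, ℤ)`. -/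
def mulRight {m : ℤ} (M : FixedDetMatrix (Fin 2) ℤ m) (A : SL(2, ℤ)) :
    FixedDetMatrix (Fin 2) ℤ m :=
  ⟨M.1 * A.1, by rw [Matrix.det_mul, M.2, A.2, mul_one]⟩

lemma smul_mulRight {m : ℤ} (B : SL(2, ℤ)) (M : FixedDetMatrix (Fin 2) ℤ m) (A : SL(2, ℤ)) :
    mulRight (B • M) A = B • mulRight M A :=
  FixedDetMatrices.ext' (Fin 2) ℤ (mul_assoc B.1 M.1 A.1)

lemma mulRight_mulRight_inv {m : ℤ} (M : FixedDetMatrix (Fin 2) ℤ m) (A : SL(2, ℤ)) :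
    mulRight (mulRight M A) A⁻¹ = M := by
  refine FixedDetMatrices.ext' (Fin 2) ℤ ?_
  change M.1 * A.1 * A⁻¹.1 = M.1
  rw [mul_assoc, ← Matrix.SpecialLinearGroup.coe_mul, mul_inv_cancel,
    Matrix.SpecialLinearGroup.coe_one, mul_one]

lemma mulRight_coe {m : ℤ} (M : FixedDetMatrix (Fin 2) ℤ m) (A : SL(2, ℤ)) :
    (mulRight M A).1 = M.1 * A.1 := rfl

/-- Right multiplication permutes the orbits of `SL(2, ℤ)`. -/
lemma sum_reps_mulRight {m : ℤ} (hm : 0 < m) {G : FixedDetMatrix (Fin 2) ℤ m → ℂ}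
    (hG : ∀ (A : SL(2, ℤ)) M, G (A • M) = G M) (A : SL(2, ℤ)) :
    ∑ M : reps m, G (mulRight M.1 A) = ∑ M : reps m, G M.1 := by
  let φ : reps m → reps m := fun M => ⟨reduce (mulRight M.1 A), reduce_mem_reps hm.ne' _⟩
  -- The representatives form a finite set, so injectivity suffices for a permutation.
  have hφ : Function.Injective φ := by
    intro M N h
    have h' : reduce (mulRight M.1 A) = reduce (mulRight N.1 A) := congrArg Subtype.val h
    obtain ⟨B, hB⟩ := exists_reduce_eq_smul (mulRight M.1 A)
    obtain ⟨C, hC⟩ := exists_reduce_eq_smul (mulRight N.1 A)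
    rw [hB, hC, ← smul_mulRight, ← smul_mulRight] at h'
    have h2 := congrArg (fun X => mulRight X A⁻¹) h'
    simp only [mulRight_mulRight_inv] at h2
    refine Subtype.ext (eq_of_mem_reps hm M.2 N.2 (A := B⁻¹ * C) ?_)
    rw [mul_smul, ← h2, inv_smul_smul]
  have := (Finite.injective_iff_bijective.mp hφ).sum_comp (fun M : reps m => G M.1)
  rw [← this]
  refine Finset.sum_congr rfl fun M _ => ?_
  obtain ⟨B, hB⟩ := exists_reduce_eq_smul (mulRight M.1 A)
  change _ = G (reduce (mulRight M.1 A))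
  rw [hB, hG]

/-- The real matrix underlying an integral matrix of positive determinant. -/
def toGL {m : ℤ} (hm : 0 < m) (M : FixedDetMatrix (Fin 2) ℤ m) : GL (Fin 2) ℝ :=
  Matrix.GeneralLinearGroup.mkOfDetNeZero (M.1.map ((↑) : ℤ → ℝ)) (by
    have h : (M.1.map ((↑) : ℤ → ℝ)).det = ((M.1.det : ℤ) : ℝ) :=
      (Int.cast_det M.1).symm
    rw [h, M.2]
    exact_mod_cast hm.ne')

lemma toGL_apply {m : ℤ} (hm : 0 < m) (M : FixedDetMatrix (Fin 2) ℤ m) (i j : Fin 2) :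
    toGL hm M i j = M.1 i j := rfl

lemma toGL_det {m : ℤ} (hm : 0 < m) (M : FixedDetMatrix (Fin 2) ℤ m) :
    0 < (toGL hm M).det.val := by
  have h : (toGL hm M).det.val = ((M.1.det : ℤ) : ℝ) := (Int.cast_det M.1).symm
  rw [h, M.2]
  exact_mod_cast hm

lemma toGL_smul {m : ℤ} (hm : 0 < m) (A : SL(2, ℤ)) (M : FixedDetMatrix (Fin 2) ℤ m) :
    toGL hm (A • M) = (A : GL (Fin 2) ℝ) * toGL hm M := by
  ext i j
  rw [toGL_apply, smul_coe, Units.val_mul, Matrix.mul_apply, Matrix.mul_apply]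
  push_cast
  rfl

lemma toGL_mulRight {m : ℤ} (hm : 0 < m) (M : FixedDetMatrix (Fin 2) ℤ m) (A : SL(2, ℤ)) :
    toGL hm (mulRight M A) = toGL hm M * (A : GL (Fin 2) ℝ) := by
  ext i j
  rw [toGL_apply, mulRight_coe, Units.val_mul, Matrix.mul_apply, Matrix.mul_apply]
  push_cast
  rfl

/-! ### The Hecke operator as a sum over orbits -/

/-- The weight of an orbit representative `M` in the Hecke sum for the `j`-th power of the
character of order twelve. -/
def heckeWeight (j : ℤ) {m : ℤ} (M : FixedDetMatrix (Fin 2) ℤ m) : ℂ :=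
  (matChar j (M.1 * !![1, 0; 0, -1]))⁻¹

lemma twelve_dvd_det {j m : ℤ} (hjm : 12 ∣ j * (m + 1)) (M : FixedDetMatrix (Fin 2) ℤ m) :
    12 ∣ j * ((M.1 * !![1, 0; 0, -1]).det - 1) := by
  rw [Matrix.det_mul, M.2, Matrix.det_fin_two_of]
  convert! (dvd_neg.mpr hjm) using 1
  ring

lemma heckeWeight_smul {j m : ℤ} (hjm : 12 ∣ j * (m + 1)) (A : SL(2, ℤ))
    (M : FixedDetMatrix (Fin 2) ℤ m) :
    heckeWeight j (A • M) = (matChar j A.1)⁻¹ * heckeWeight j M := by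
  rw [heckeWeight, heckeWeight, smul_coe, mul_assoc, matChar_SL_mul A (twelve_dvd_det hjm M),
    mul_inv]

/-- With `ε = diag(1, -1)` one has `T ε = ε T⁻¹`; this inversion is the source of the conjugate
multiplier. The case of `S` is the same. -/
lemma heckeWeight_mulRight_T {j m : ℤ} (hjm : 12 ∣ j * (m + 1))
    (M : FixedDetMatrix (Fin 2) ℤ m) :
    heckeWeight j (mulRight M ModularGroup.T) = e12 j * heckeWeight j M := by
  rw [heckeWeight, heckeWeight, mulRight_coe]
  have h : M.1 * ModularGroup.T.1 * !![1, 0; 0, -1] =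
      M.1 * !![1, 0; 0, -1] * !![1, -1; 0, 1] := by
    rw [mul_assoc, mul_assoc]
    simp [ModularGroup.T]
  rw [h, matChar_mul_T_inv (twelve_dvd_det hjm M), mul_inv, e12_neg, inv_inv]

lemma heckeWeight_mulRight_S {j m : ℤ} (hjm : 12 ∣ j * (m + 1))
    (M : FixedDetMatrix (Fin 2) ℤ m) :
    heckeWeight j (mulRight M ModularGroup.S) = e12 (-3 * j) * heckeWeight j M := by
  rw [heckeWeight, heckeWeight, mulRight_coe]
  have h : M.1 * ModularGroup.S.1 * !![1, 0; 0, -1] =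
      M.1 * !![1, 0; 0, -1] * !![0, 1; -1, 0] := by
    rw [mul_assoc, mul_assoc]
    simp [ModularGroup.S]
  rw [h, matChar_mul_S_inv (twelve_dvd_det hjm M), mul_inv, neg_mul, e12_neg]

/-- The sum over all orbits of `SL(2, ℤ)` on the integral matrices of determinant `m`. -/
def orbitSum (j k : ℤ) {m : ℤ} (hm : 0 < m) (f : ℍ → ℂ) (z : ℍ) : ℂ :=
  ∑ M : reps m, heckeWeight j M.1 * glSlash k (toGL hm M.1) f z

/-- The left factors from the weight and from `f` cancel, so each term depends only on its orbit.
Right multiplication then reorders the orbits, at the cost of the factor by which the weight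
changes. -/
lemma slash_orbitSum {j k m : ℤ} (hm : 0 < m) (hjm : 12 ∣ j * (m + 1)) {f : ℍ → ℂ}
    (hf : ∀ A : SL(2, ℤ), slash k A f = fun z => matChar j A.1 * f z) (A : SL(2, ℤ)) :
    slash k A (orbitSum j k hm f) = fun z => matChar (-j) A.1 * orbitSum j k hm f z := by
  have key : ∀ (B : SL(2, ℤ)) (r : ℂ), r ≠ 0 →
      (∀ M : FixedDetMatrix (Fin 2) ℤ m, heckeWeight j (mulRight M B) = r * heckeWeight j M) →
      slash k B (orbitSum j k hm f) = fun z => r⁻¹ * orbitSum j k hm f z := by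
    intro B r hr hB
    ext z
    have hG : ∀ (A : SL(2, ℤ)) (M : FixedDetMatrix (Fin 2) ℤ m),
        heckeWeight j (A • M) * glSlash k (toGL hm (A • M)) f z =
          heckeWeight j M * glSlash k (toGL hm M) f z := by
      intro A M
      rw [heckeWeight_smul hjm, toGL_smul, glSlash_mul _ _ _ (toGL_det hm M), ← slash_eq_glSlash,
        hf, glSlash_const_mul]
      have := matChar_ne_zero j A.1
      field_simp
    have hsum := sum_reps_mulRight hm
      (G := fun M => heckeWeight j M * glSlash k (toGL hm M) f z) hG B
    rw [orbitSum, ← hsum, slash_eq_glSlash, glSlash]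
    simp only [orbitSum, Finset.mul_sum]
    refine Finset.sum_congr rfl fun M _ => ?_
    rw [hB, toGL_mulRight, glSlash_mul _ _ _ (by simp)]
    rw [show glSlash k (B : GL (Fin 2) ℝ) (glSlash k (toGL hm M.1) f) z =
      (phase k (B : GL (Fin 2) ℝ) z)⁻¹ *
        glSlash k (toGL hm M.1) f ((B : GL (Fin 2) ℝ) • z) from rfl]
    field_simp
  have hid : 12 ∣ (-j) * ((1 : Matrix (Fin 2) (Fin 2) ℤ).det - 1) := by simp
  refine slash_eq_matChar_of_generators ?_ ?_ A
  · rw [key _ _ (e12_ne_zero _) (heckeWeight_mulRight_S hjm), ← mul_one ModularGroup.S.1,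
      matChar_S_mul hid, matChar_one, mul_one, ← e12_neg]
    ring_nf
  · rw [key _ _ (e12_ne_zero _) (heckeWeight_mulRight_T hjm), ← mul_one ModularGroup.T.1,
      matChar_T_mul hid, matChar_one, mul_one, ← e12_neg]

open MeasureTheory

/-! ### Square integrability over Siegel sets -/

/-- The part of the strip `|x| ≤ X` above height `c`. -/
def siegelSet (X c : ℝ) : Set ℍ := {z | |z.re| ≤ X ∧ c ≤ z.im}

lemma isCompact_box {X c C : ℝ} (hc : 0 < c) :
    IsCompact {z : ℍ | |z.re| ≤ X ∧ c ≤ z.im ∧ z.im ≤ C} := by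
  rw [UpperHalfPlane.isEmbedding_coe.isCompact_iff]
  have : (UpperHalfPlane.coe '' {z : ℍ | |z.re| ≤ X ∧ c ≤ z.im ∧ z.im ≤ C}) =
      (Set.Icc (-X) X) ×ℂ (Set.Icc c C) := by
    ext w
    simp only [Set.mem_image, Set.mem_ofPred_eq, Complex.mem_reProdIm, Set.mem_Icc, abs_le]
    constructor
    · rintro ⟨z, hz, rfl⟩
      exact hz
    · intro h
      exact ⟨⟨w, hc.trans_le h.2.1⟩, h, rfl⟩
  rw [this]
  exact isCompact_Icc.reProdIm isCompact_Icc

/-- The part of the Siegel set below height 1 is compact; the part above it is covered by finitely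
many integer translates of the fundamental domain, over which the invariant `h` is integrable. -/
lemma integrableOn_siegelSet {h : ℍ → ℝ} (hcont : Continuous h)
    (hinv : ∀ (A : SL(2, ℤ)) z, h (A • z) = h z) (hfd : IntegrableOn h ModularGroup.fd)
    {X c : ℝ} (hc : 0 < c) : IntegrableOn h (siegelSet X c) := by
  have hK : IntegrableOn h {z : ℍ | |z.re| ≤ X ∧ c ≤ z.im ∧ z.im ≤ 1} :=
    hcont.continuousOn.integrableOn_compact (isCompact_box hc)
  have hT : ∀ n : ℤ, IntegrableOn h
      ((fun z : ℍ => ((ModularGroup.T ^ n : SL(2, ℤ)) : GL (Fin 2) ℝ) • z) ⁻¹'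
        ModularGroup.fd) := by
    intro n
    have h1 := (measurePreserving_smul ((ModularGroup.T ^ n : SL(2, ℤ)) : GL (Fin 2) ℝ)
      (volume : Measure ℍ)).integrableOn_comp_preimage (f := h) (s := ModularGroup.fd)
      (measurableEmbedding_const_smul _)
    have h2 : h ∘ (fun z : ℍ => ((ModularGroup.T ^ n : SL(2, ℤ)) : GL (Fin 2) ℝ) • z) = h := by
      ext z
      exact hinv _ z
    rw [h2] at h1
    exact h1.mpr hfd
  have hU : IntegrableOn h (⋃ n ∈ Set.Icc (-(⌈X⌉ + 1)) (⌈X⌉ + 1),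
      ((fun z : ℍ => ((ModularGroup.T ^ n : SL(2, ℤ)) : GL (Fin 2) ℝ) • z) ⁻¹'
        ModularGroup.fd)) :=
    (integrableOn_finite_biUnion (Set.finite_Icc _ _)).mpr fun n _ => hT n
  refine (hK.union hU).mono_set fun z hz => ?_
  by_cases h1 : z.im ≤ 1
  · exact Or.inl ⟨hz.1, hz.2, h1⟩
  · right
    push Not at h1
    have hr := abs_le.mp (abs_sub_round z.re)
    have hX := abs_le.mp hz.1
    have hceil := Int.le_ceil X
    simp only [Set.mem_iUnion, Set.mem_preimage]
    -- Rounding moves the real part into `[-1/2, 1/2]`, and height above 1 already forces `|z| > 1`.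
    refine ⟨-round z.re, ?_, ?_⟩
    · have h1 : ((round z.re : ℤ) : ℝ) < ((⌈X⌉ + 2 : ℤ) : ℝ) := by push_cast; linarith
      have h2 : ((-(⌈X⌉ + 2) : ℤ) : ℝ) < ((round z.re : ℤ) : ℝ) := by push_cast; linarith
      have h1' := Int.cast_lt.mp h1
      have h2' := Int.cast_lt.mp h2
      constructor <;> omega
    · rw [← ModularGroup.sl_moeb, UpperHalfPlane.modular_T_zpow_smul]
      refine ⟨?_, ?_⟩
      · rw [Complex.normSq_apply, UpperHalfPlane.coe_im, UpperHalfPlane.vadd_im]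
        nlinarith [mul_self_nonneg (((-round z.re : ℤ) : ℝ) +ᵥ z : ℍ).re]
      · rw [UpperHalfPlane.vadd_re]
        push_cast
        rw [neg_add_eq_sub]
        exact abs_sub_round z.re

/-! ### Composition with the affine maps `z ↦ (az + b)/d` -/

section reps

variable {m : ℤ} (hm : 0 < m) {M : FixedDetMatrix (Fin 2) ℤ m} (hM : M ∈ reps m)
include hM

lemma denom_toGL_of_mem_reps (z : ℂ) : UpperHalfPlane.denom (toGL hm M) z = (M.1 1 1 : ℂ) := by
  rw [UpperHalfPlane.denom, toGL_apply, toGL_apply, hM.1]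
  simp

lemma coe_toGL_smul (z : ℍ) :
    ((toGL hm M • z : ℍ) : ℂ) = (M.1 0 0 * z + M.1 0 1) / M.1 1 1 := by
  rw [UpperHalfPlane.coe_smul_of_det_pos (toGL_det hm M), denom_toGL_of_mem_reps hm hM,
    UpperHalfPlane.num, toGL_apply, toGL_apply]
  simp

lemma phase_toGL (k : ℤ) (z : ℍ) : phase k (toGL hm M) z = 1 := by
  have hd : (0 : ℝ) < M.1 1 1 := by exact_mod_cast diag_pos_of_mem_reps hm hM
  have hd' : ((M.1 1 1 : ℤ) : ℂ) = ((M.1 1 1 : ℝ) : ℂ) := by push_cast; rfl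
  rw [phase, denom_toGL_of_mem_reps hm hM, hd', Complex.norm_real, Real.norm_of_nonneg hd.le,
    div_self (by exact_mod_cast hd.ne'), one_zpow]

lemma glSlash_toGL (k : ℤ) (f : ℍ → ℂ) : glSlash k (toGL hm M) f = fun z => f (toGL hm M • z) := by
  ext z
  rw [glSlash, phase_toGL hm hM, inv_one, one_mul]

lemma integrableOn_comp_toGL {h : ℍ → ℝ} (hcont : Continuous h)
    (hinv : ∀ (A : SL(2, ℤ)) z, h (A • z) = h z) (hfd : IntegrableOn h ModularGroup.fd) :
    IntegrableOn (fun z => h (toGL hm M • z)) ModularGroup.fd := by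
  have hd : (0 : ℝ) < M.1 1 1 := by exact_mod_cast diag_pos_of_mem_reps hm hM
  have ha : (0 : ℝ) < M.1 0 0 := by exact_mod_cast hM.2.1
  have hb : (0 : ℝ) ≤ M.1 0 1 := by exact_mod_cast hM.2.2.1
  have h1 := (measurePreserving_smul (toGL hm M) (volume : Measure ℍ)).integrableOn_image
    (f := h) (s := ModularGroup.fd) (measurableEmbedding_const_smul _)
  -- On the fundamental domain `|x| ≤ 1/2 ≤ 1` and `y ≥ √3/2 ≥ 1/2`; cruder bounds suffice for the
  -- image.
  refine h1.mp ((integrableOn_siegelSet hcont hinv hfd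
    (X := (M.1 0 0 + M.1 0 1) / M.1 1 1) (c := M.1 0 0 / M.1 1 1 * (1 / 2))
    (by positivity)).mono_set ?_)
  rintro _ ⟨z, hz, rfl⟩
  have hcoe := coe_toGL_smul hm hM z
  have hre : (toGL hm M • z : ℍ).re = (M.1 0 0 * z.re + M.1 0 1) / M.1 1 1 := by
    rw [← UpperHalfPlane.coe_re, hcoe, ← Complex.ofReal_intCast, ← Complex.ofReal_intCast,
      ← Complex.ofReal_intCast, Complex.div_ofReal_re]
    simp
  have him : (toGL hm M • z : ℍ).im = M.1 0 0 / M.1 1 1 * z.im := by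
    rw [← UpperHalfPlane.coe_im, hcoe, ← Complex.ofReal_intCast, ← Complex.ofReal_intCast,
      ← Complex.ofReal_intCast, Complex.div_ofReal_im]
    simp
    ring
  have hx := abs_le.mp hz.2
  have hy := ModularGroup.three_le_four_mul_im_sq_of_mem_fd hz
  constructor
  · rw [hre, abs_div, abs_of_pos hd]
    gcongr
    rw [abs_le]
    constructor <;> nlinarith
  · rw [him]
    have := z.im_pos
    gcongr
    nlinarith

end reps

/-! ### The eigenvalue equation -/

lemma fderiv_comp_affine {F : ℂ → ℂ} {r : ℝ} {t w : ℂ}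
    (hF : DifferentiableAt ℝ F (r • w + t)) :
    fderiv ℝ (fun w => F (r • w + t)) w 1 = r * fderiv ℝ F (r • w + t) 1 := by
  have h1 : HasFDerivAt (fun w : ℂ => r • w + t) (r • ContinuousLinearMap.id ℝ ℂ) w :=
    ((hasFDerivAt_id w).const_smul r).add_const t
  have h2 := (HasFDerivAt.comp w hF.hasFDerivAt h1).fderiv
  rw [Function.comp_def] at h2
  rw [h2]
  simp

lemma laplacian_comp_affine {F : ℂ → ℂ} {r : ℝ} (hr : r ≠ 0) {t w : ℂ} :
    Laplacian.laplacian (fun w => F (r • w + t)) w =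
      r ^ 2 * Laplacian.laplacian F (r • w + t) := by
  let e : ℂ ≃L[ℝ] ℂ := ContinuousLinearEquiv.smulLeft (Units.mk0 r hr)
  have he : ∀ x, e x = r • x := fun x => rfl
  have h1 := e.iteratedFDerivWithin_comp_right (fun w => F (w + t)) uniqueDiffOn_univ
    (x := w) (Set.mem_univ _) 2
  rw [Set.preimage_univ, iteratedFDerivWithin_univ, iteratedFDerivWithin_univ,
    iteratedFDeriv_comp_add_right] at h1
  have h2 : (fun w => F (r • w + t)) = (fun w => F (w + t)) ∘ e := by
    ext x
    simp [he]
  have hv : ∀ v : ℂ, (iteratedFDeriv ℝ 2 (fun w => F (r • w + t)) w) ![v, v] =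
      r ^ 2 * (iteratedFDeriv ℝ 2 F (r • w + t)) ![v, v] := by
    intro v
    rw [h2, h1, ContinuousMultilinearMap.compContinuousLinearMap_apply, he]
    have h3 : (fun i => (e : ℂ →L[ℝ] ℂ) ((![v, v] : Fin 2 → ℂ) i)) =
        fun i => r • (![v, v] : Fin 2 → ℂ) i := rfl
    rw [h3, ContinuousMultilinearMap.map_smul_univ]
    simp [pow_two]
  rw [InnerProductSpace.laplacian_eq_iteratedFDeriv_complexPlane,
    InnerProductSpace.laplacian_eq_iteratedFDeriv_complexPlane]
  simp only [hv]
  ring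

lemma isOpen_im_pos : IsOpen {z : ℂ | 0 < z.im} := isOpen_lt continuous_const Complex.continuous_im

/-- The `C²` eigenfunctions of the weight `k` Laplacian that are square integrable over the
standard fundamental domain. -/
def eigenspaceFd (k : ℤ) (R : ℝ) : Submodule ℂ (ℍ → ℂ) where
  carrier := {f | ContDiffOn ℝ 2 (f ∘ UpperHalfPlane.ofComplex) {z : ℂ | 0 < z.im} ∧
    (∀ z : ℍ, weightLaplacian k f z + ((1 / 4 + R ^ 2 : ℝ) : ℂ) * f z = 0) ∧
    MemLp f 2 (volume.restrict ModularGroup.fd)}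
  zero_mem' := by
    refine ⟨contDiffOn_const, fun z => ?_, MemLp.zero⟩
    have h : ((0 : ℍ → ℂ) ∘ UpperHalfPlane.ofComplex) = fun _ => (0 : ℂ) := rfl
    rw [weightLaplacian, h, InnerProductSpace.laplacian_const]
    simp
  add_mem' := by
    rintro f g ⟨hf, hf', hf2⟩ ⟨hg, hg', hg2⟩
    refine ⟨hf.add hg, fun z => ?_, hf2.add hg2⟩
    have h : ((f + g) ∘ UpperHalfPlane.ofComplex) =
      (f ∘ UpperHalfPlane.ofComplex) + (g ∘ UpperHalfPlane.ofComplex) := rfl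
    have hfz := hf.contDiffAt (isOpen_im_pos.mem_nhds z.2)
    have hgz := hg.contDiffAt (isOpen_im_pos.mem_nhds z.2)
    have h1 := hf' z
    have h2 := hg' z
    rw [weightLaplacian] at *
    rw [h, hfz.laplacian_add hgz, fderiv_add (hfz.differentiableAt (by simp))
      (hgz.differentiableAt (by simp))]
    rw [_root_.add_apply, Pi.add_apply]
    linear_combination h1 + h2
  smul_mem' := by
    rintro r f ⟨hf, hf', hf2⟩
    refine ⟨contDiffOn_const.smul hf, fun z => ?_, hf2.const_smul r⟩
    have h : ((r • f) ∘ UpperHalfPlane.ofComplex) =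
      r • (f ∘ UpperHalfPlane.ofComplex) := rfl
    have hfz := hf.contDiffAt (isOpen_im_pos.mem_nhds z.2)
    have h1 := hf' z
    rw [weightLaplacian] at *
    rw [h, InnerProductSpace.laplacian_smul r hfz, fderiv_const_smul
      (hfz.differentiableAt (by simp)), Pi.smul_apply]
    rw [_root_.smul_apply, smul_eq_mul, smul_eq_mul, smul_eq_mul]
    linear_combination r * h1

lemma continuous_of_contDiffOn {f : ℍ → ℂ}
    (hf : ContDiffOn ℝ 2 (f ∘ UpperHalfPlane.ofComplex) {z : ℂ | 0 < z.im}) : Continuous f := by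
  have h : f = (f ∘ UpperHalfPlane.ofComplex) ∘ UpperHalfPlane.coe := by
    ext z
    simp
  rw [h]
  exact hf.continuousOn.comp_continuous UpperHalfPlane.continuous_coe fun z => z.2

lemma IsMaassWaveform.continuous {v : SL(2, ℤ) → ℂ} {k : ℤ} {R : ℝ} {f : ℍ → ℂ}
    (hf : IsMaassWaveform v k R f) : Continuous f := continuous_of_contDiffOn hf.contDiffOn

lemma isMaassWaveform_iff {v : SL(2, ℤ) → ℂ} {k : ℤ} {R : ℝ} {f : ℍ → ℂ} :
    IsMaassWaveform v k R f ↔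
      f ∈ eigenspaceFd k R ∧ ∀ (A : SL(2, ℤ)) (z : ℍ), slash k A f z = v A * f z := by
  constructor
  · intro h
    exact ⟨⟨h.contDiffOn, h.eigen, (memLp_two_iff_integrable_sq_norm
      h.continuous.aestronglyMeasurable).mpr h.sq_integrable⟩, h.slash_eq⟩
  · rintro ⟨⟨h1, h2, h3⟩, h4⟩
    exact ⟨h1, h4, h2, (memLp_two_iff_integrable_sq_norm h3.1).mp h3⟩

lemma norm_phase (k : ℤ) (g : GL (Fin 2) ℝ) (z : ℍ) : ‖phase k g z‖ = 1 := by
  rw [phase, norm_zpow, norm_div, Complex.norm_real, norm_norm, div_self, one_zpow]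
  simp

lemma norm_smul_eq {k j : ℤ} {f : ℍ → ℂ}
    (hf : ∀ (A : SL(2, ℤ)) (z : ℍ), slash k A f z = matChar j A.1 * f z) (A : SL(2, ℤ)) (z : ℍ) :
    ‖f (A • z)‖ = ‖f z‖ := by
  have h := congrArg norm (hf A z)
  rwa [slash, norm_mul, norm_mul, norm_matChar, one_mul, norm_inv, autFactor_eq, norm_phase,
    inv_one, one_mul] at h

/-- Under `w ↦ rw + t` with `t` real, `y²Δ` and `y ∂/∂x` are invariant. The transformation law
enters only through the invariance of `|f|`, needed for integrability. -/
lemma comp_toGL_mem_eigenspaceFd {m : ℤ} (hm : 0 < m) {M : FixedDetMatrix (Fin 2) ℤ m}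
    (hM : M ∈ reps m) {k j : ℤ} {R : ℝ} {f : ℍ → ℂ} (hf : f ∈ eigenspaceFd k R)
    (hfs : ∀ (A : SL(2, ℤ)) (z : ℍ), slash k A f z = matChar j A.1 * f z) :
    (fun z => f (toGL hm M • z)) ∈ eigenspaceFd k R := by
  have hd : (0 : ℝ) < M.1 1 1 := by exact_mod_cast diag_pos_of_mem_reps hm hM
  have ha : (0 : ℝ) < M.1 0 0 := by exact_mod_cast hM.2.1
  obtain ⟨hf1, hf2, hf3⟩ := hf
  have hcont : Continuous f := continuous_of_contDiffOn hf1
  set F := f ∘ UpperHalfPlane.ofComplex with hF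
  set r : ℝ := M.1 0 0 / M.1 1 1 with hr
  set t : ℂ := (M.1 0 1 : ℂ) / M.1 1 1 with ht
  have hr0 : 0 < r := div_pos ha hd
  have hcoe : ∀ z : ℍ, ((toGL hm M • z : ℍ) : ℂ) = r • (z : ℂ) + t := by
    intro z
    rw [coe_toGL_smul hm hM, hr, ht, Complex.real_smul]
    push_cast
    ring
  have hcomp : ∀ w : ℂ, 0 < w.im →
      ((fun z => f (toGL hm M • z)) ∘ UpperHalfPlane.ofComplex) w = F (r • w + t) := by
    intro w hw
    have h := hcoe ⟨w, hw⟩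
    rw [Function.comp_apply, UpperHalfPlane.ofComplex_apply_of_im_pos hw, hF, Function.comp_apply]
    change _ = f (UpperHalfPlane.ofComplex (r • ((⟨w, hw⟩ : ℍ) : ℂ) + t))
    rw [← h, UpperHalfPlane.ofComplex_apply]
  have him : ∀ w : ℂ, 0 < w.im → 0 < (r • w + t).im := by
    intro w hw
    have h := (toGL hm M • (⟨w, hw⟩ : ℍ)).2
    rwa [hcoe] at h
  refine ⟨?_, fun z => ?_, ?_⟩
  · refine ContDiffOn.congr (f := fun w => F (r • w + t)) ?_ hcomp
    refine hf1.comp (t := {z : ℂ | 0 < z.im}) (f := fun w : ℂ => r • w + t) ?_ him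
    exact ((contDiff_const_smul r).add contDiff_const).contDiffOn
  · have hev : ((fun z => f (toGL hm M • z)) ∘ UpperHalfPlane.ofComplex) =ᶠ[nhds (z : ℂ)]
        fun w => F (r • w + t) := by
      filter_upwards [isOpen_im_pos.mem_nhds z.2] with w hw using hcomp w hw
    have hdiff : DifferentiableAt ℝ F (r • (z : ℂ) + t) :=
      (hf1.contDiffAt (isOpen_im_pos.mem_nhds (him z z.2))).differentiableAt (by simp)
    have h := hf2 (toGL hm M • z)
    have hz : (toGL hm M • z : ℍ).im = r * z.im := by
      rw [← UpperHalfPlane.coe_im, hcoe, ht, ← Complex.ofReal_intCast, ← Complex.ofReal_intCast,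
        ← Complex.ofReal_div]
      simp
    rw [weightLaplacian, ← hF, hz, hcoe] at h
    rw [weightLaplacian, InnerProductSpace.laplacian_congr_nhds hev |>.self_of_nhds, hev.fderiv_eq,
      fderiv_comp_affine hdiff, laplacian_comp_affine hr0.ne']
    push_cast at h ⊢
    linear_combination h
  · have hinv : ∀ (A : SL(2, ℤ)) z, ‖f (A • z)‖ ^ 2 = ‖f z‖ ^ 2 := by
      intro A z
      rw [norm_smul_eq hfs]
    have h3 := (memLp_two_iff_integrable_sq_norm hf3.1).mp hf3
    refine (memLp_two_iff_integrable_sq_norm ?_).mpr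
      (integrableOn_comp_toGL hm hM (hcont.norm.pow 2) hinv h3)
    exact (hcont.comp (continuous_const_smul _)).aestronglyMeasurable

/-! ### Hecke operators preserve Maass waveforms -/

lemma chi_eq (k : ℤ) (d : ℕ) : chi k d = e12 (3 * (k * (d - 1))) := by
  rw [chi, e12_mul, e12_three]

lemma neg_one_zpow_eq (k : ℤ) : (-1 : ℂ) ^ k = e12 (6 * k) := by
  rw [e12_mul, show (6 : ℤ) = 3 + 3 by rfl, e12_add, e12_three, Complex.I_mul_I]

/-- Either `k` is even, or `ad` is odd and then so is `d`. -/
lemma even_mul_pred {k m a d : ℤ} (h : 12 ∣ k * (m + 1)) (had : a * d = m) :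
    2 ∣ k * (d - 1) := by
  subst had
  have h2 : (2 : ℤ) ∣ k * (a * d + 1) := Dvd.dvd.trans (by norm_num) h
  rcases Int.prime_two.dvd_or_dvd h2 with h | h
  · exact h.mul_right _
  · refine Dvd.dvd.mul_left ?_ _
    have hodd : ¬ Even (a * d) := by
      rintro ⟨q, hq⟩
      rw [hq] at h
      omega
    rw [Int.not_even_iff_odd, Int.odd_mul] at hodd
    obtain ⟨q, hq⟩ := hodd.2
    omega

lemma dvd_mul_succ {j k m : ℤ} (hj : j = k ∨ j = -k) (hkm : 12 ∣ k * (m + 1)) :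
    12 ∣ j * (m + 1) := by
  rcases hj with rfl | rfl
  · exact hkm
  · rw [neg_mul]
    exact dvd_neg.mpr hkm

/-- For a triangular matrix the exponent of the weight is `-j(bd + 3d + 3)`. The two sides then
differ by `6k(d - 1)` if `j = k` and by `-12k` if `j = -k`. -/
lemma chi_mul_eq_heckeWeight {j k m : ℤ} (hj : j = k ∨ j = -k) (hkm : 12 ∣ k * (m + 1))
    {a b d : ℕ} (had : (a : ℤ) * d = m) (M : FixedDetMatrix (Fin 2) ℤ m)
    (hM : M.1 = !![(a : ℤ), b; 0, d]) :
    chi k d * e12 j ^ (-((b : ℤ) * d)) = (-1) ^ k * heckeWeight j M := by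
  rw [chi_eq, neg_one_zpow_eq, heckeWeight, matChar, hM, ← e12_neg, ← e12_mul, ← e12_add,
    ← e12_add]
  apply e12_congr
  obtain ⟨q, hq⟩ := even_mul_pred hkm had
  simp only [abPoly, Matrix.mul_apply, Fin.sum_univ_two, Matrix.of_apply, Matrix.cons_val_zero,
    Matrix.cons_val_one]
  simp
  rcases hj with rfl | rfl
  · exact ⟨q, by linear_combination 6 * hq⟩
  · exact ⟨-k, by ring⟩

/-- The triples `(a, d, b)` with `ad = m`, `0 ≤ b < d` are exactly the triangular orbit
representatives, on which the automorphy factor is 1. -/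
lemma heckeSum_eq_orbitSum {j k : ℤ} {m : ℕ} (hj : j = k ∨ j = -k) (hm : 0 < (m : ℤ))
    (hkm : 12 ∣ k * ((m : ℤ) + 1)) (f : ℍ → ℂ) :
    heckeSum (e12 j) k m f =
      (((1 / Real.sqrt m : ℝ) : ℂ) * (-1) ^ k) • orbitSum j k hm f := by
  ext z
  rw [Pi.smul_apply, smul_eq_mul, mul_assoc]
  change ((1 / Real.sqrt m : ℝ) : ℂ) * _ = _
  congr 1
  rw [orbitSum, Finset.mul_sum]
  simp_rw [Finset.mul_sum]
  rw [Finset.sum_sigma']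
  have had : ∀ x ∈ m.divisorsAntidiagonal.sigma (fun p : ℕ × ℕ => Finset.range p.2),
      (x.1.1 : ℤ) * x.1.2 = m := by
    intro x hx
    rw [Finset.mem_sigma, Nat.mem_divisorsAntidiagonal] at hx
    exact_mod_cast hx.1.1
  have hlt : ∀ x ∈ m.divisorsAntidiagonal.sigma (fun p : ℕ × ℕ => Finset.range p.2),
      x.2 < x.1.2 := by
    intro x hx
    rw [Finset.mem_sigma, Finset.mem_range] at hx
    exact hx.2
  let i : ∀ x ∈ m.divisorsAntidiagonal.sigma (fun p : ℕ × ℕ => Finset.range p.2),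
      reps (m : ℤ) := fun x hx =>
    ⟨⟨!![(x.1.1 : ℤ), x.2; 0, x.1.2], by
      rw [Matrix.det_fin_two_of, mul_zero, sub_zero, had x hx]⟩, by
      have h1 := had x hx
      have h2 : 0 < x.1.1 := by
        rcases Nat.eq_zero_or_pos x.1.1 with h | h
        · rw [h] at h1
          simp at h1
          omega
        · exact h
      refine ⟨rfl, ?_, ?_, ?_⟩
      · change (0 : ℤ) < (x.1.1 : ℤ)
        exact_mod_cast h2
      · exact Int.natCast_nonneg _
      · change |((x.2 : ℕ) : ℤ)| < |((x.1.2 : ℕ) : ℤ)|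
        rw [Nat.abs_cast, Nat.abs_cast]
        exact_mod_cast hlt x hx⟩
  refine Finset.sum_bij i (fun _ _ => Finset.mem_univ _) ?_ ?_ ?_
  · rintro ⟨⟨a, d⟩, b⟩ hx ⟨⟨a', d'⟩, b'⟩ hy h
    have h' : !![(a : ℤ), b; 0, d] = !![(a' : ℤ), b'; 0, d'] :=
      congrArg (fun M : reps (m : ℤ) => M.1.1) h
    have h00 := congrFun (congrFun h' 0) 0
    have h01 := congrFun (congrFun h' 0) 1
    have h11 := congrFun (congrFun h' 1) 1
    simp at h00 h01 h11
    subst h00 h01 h11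
    rfl
  · rintro ⟨M, hM⟩ -
    have hd := diag_pos_of_mem_reps hm hM
    have hdiag := diag_mul_of_mem_reps hM
    obtain ⟨hc, ha, hb, hbd⟩ := hM
    rw [abs_of_nonneg hb, abs_of_pos hd] at hbd
    have e0 : ((M.1 0 0).toNat : ℤ) = M.1 0 0 := Int.toNat_of_nonneg ha.le
    have e1 : ((M.1 1 1).toNat : ℤ) = M.1 1 1 := Int.toNat_of_nonneg hd.le
    have e2 : ((M.1 0 1).toNat : ℤ) = M.1 0 1 := Int.toNat_of_nonneg hb
    refine ⟨⟨((M.1 0 0).toNat, (M.1 1 1).toNat), (M.1 0 1).toNat⟩, ?_, ?_⟩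
    · rw [Finset.mem_sigma, Nat.mem_divisorsAntidiagonal, Finset.mem_range]
      refine ⟨⟨?_, ?_⟩, ?_⟩
      · zify
        rw [e0, e1, hdiag]
      · omega
      · zify
        rwa [e2, e1]
    · refine Subtype.ext (FixedDetMatrices.ext (Fin 2) ℤ fun p q => ?_)
      fin_cases p <;> fin_cases q
      · exact e0
      · exact e2
      · exact hc.symm
      · exact e1
  · intro x hx
    have hM := (i x hx).2
    rw [← mul_assoc, chi_mul_eq_heckeWeight hj hkm (had x hx) (i x hx).1 rfl, glSlash_toGL hm hM,
      mul_assoc]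
    congr 3
    have h := coe_toGL_smul hm hM z
    have h' : ((toGL hm (i x hx).1 • z : ℍ) : ℂ) = (x.1.1 * z + x.2) / x.1.2 := by
      rw [h]
      simp [i]
    rw [← h', UpperHalfPlane.ofComplex_apply]

lemma orbitSum_mem_eigenspaceFd {j k l m : ℤ} (hm : 0 < m) {R : ℝ} {f : ℍ → ℂ}
    (hf : f ∈ eigenspaceFd k R)
    (hfs : ∀ (A : SL(2, ℤ)) (z : ℍ), slash k A f z = matChar l A.1 * f z) :
    orbitSum j k hm f ∈ eigenspaceFd k R := by
  have h : orbitSum j k hm f =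
      ∑ M : reps m, heckeWeight j M.1 • (fun z => f (toGL hm M.1 • z)) := by
    ext z
    rw [orbitSum, Finset.sum_apply]
    refine Finset.sum_congr rfl fun M _ => ?_
    rw [glSlash_toGL hm M.2]
    rfl
  rw [h]
  exact Submodule.sum_mem _ fun M _ =>
    Submodule.smul_mem _ _ (comp_toGL_mem_eigenspaceFd hm M.2 hf hfs)

/-- The Hecke operator for the `j`-th power of the character of order twelve conjugates it. -/
lemma isMaassWaveform_heckeSum {j k : ℤ} {m : ℕ} (hj : j = k ∨ j = -k) (hm : 0 < m)
    (hkm : 12 ∣ k * ((m : ℤ) + 1)) {R : ℝ} {f : ℍ → ℂ}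
    (hf : IsMaassWaveform (fun A => matChar j A.1) k R f) :
    IsMaassWaveform (fun A => matChar (-j) A.1) k R (heckeSum (e12 j) k m f) := by
  rw [isMaassWaveform_iff] at hf ⊢
  obtain ⟨h1, h2⟩ := hf
  have hm' : 0 < (m : ℤ) := by exact_mod_cast hm
  rw [heckeSum_eq_orbitSum hj hm' hkm]
  refine ⟨Submodule.smul_mem _ _ (orbitSum_mem_eigenspaceFd hm' h1 h2), fun A z => ?_⟩
  have h3 := slash_orbitSum hm' (dvd_mul_succ hj hkm) (fun A => funext (h2 A)) A
  have h4 := congrFun (slash_const_mul k A (((1 / Real.sqrt m : ℝ) : ℂ) * (-1) ^ k)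
    (orbitSum j k hm' f)) z
  rw [h3] at h4
  refine h4.trans ?_
  rw [Pi.smul_apply, smul_eq_mul]
  ring

/-! ### Fourier expansions -/

lemma ofComplex_affine_re_im {a d : ℕ} (ha : 0 < a) (hd : 0 < d) (b : ℕ) (z : ℍ) :
    (UpperHalfPlane.ofComplex ((a * z + b) / d)).re = (a * z.re + b) / d ∧
      (UpperHalfPlane.ofComplex ((a * z + b) / d)).im = a * z.im / d := by
  have hre : (((a : ℂ) * z + b) / d).re = (a * z.re + b) / d := by
    rw [← Complex.ofReal_natCast d, Complex.div_ofReal_re]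
    simp
  have him : (((a : ℂ) * z + b) / d).im = a * z.im / d := by
    rw [← Complex.ofReal_natCast d, Complex.div_ofReal_im]
    simp
  have hpos : 0 < (((a : ℂ) * z + b) / d).im := by
    rw [him]
    have := z.im_pos
    positivity
  rw [UpperHalfPlane.ofComplex_apply_of_im_pos hpos]
  exact ⟨hre, him⟩

lemma whittakerTerm_affine (k : ℤ) (R ν : ℝ) {a d : ℕ} (ha : 0 < a) (hd : 0 < d) (b : ℕ) (z : ℍ) :
    whittakerTerm k R ν (UpperHalfPlane.ofComplex ((a * z + b) / d)) =
      (Real.sqrt (a / d) : ℂ) * Complex.exp (2 * Real.pi * Complex.I * (ν * b / d : ℝ)) *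
        whittakerTerm k R (ν * a / d) z := by
  obtain ⟨hre, him⟩ := ofComplex_affine_re_im ha hd b z
  have hr : (0 : ℝ) < a / d := by positivity
  have habs : |ν * a / d| = |ν| * (a / d) := by
    rw [mul_div_assoc, abs_mul, abs_of_pos hr]
  have hsign : Real.sign (ν * a / d) = Real.sign ν := by
    rw [mul_div_assoc]
    rcases lt_trichotomy ν 0 with h | rfl | h
    · rw [Real.sign_of_neg h, Real.sign_of_neg (mul_neg_of_neg_of_pos h hr)]
    · rw [zero_mul]
    · rw [Real.sign_of_pos h, Real.sign_of_pos (mul_pos h hr)]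
  have hexp : Complex.exp (2 * Real.pi * Complex.I * (ν * ((a * z.re + b) / d) : ℝ)) =
      Complex.exp (2 * Real.pi * Complex.I * (ν * b / d : ℝ)) *
        Complex.exp (2 * Real.pi * Complex.I * (ν * a / d * z.re : ℝ)) := by
    rw [← Complex.exp_add]
    congr 1
    push_cast
    ring
  -- This also holds at `ν = 0`, where both sides vanish because `1 / 0 = 0`.
  have hsqrt : ((1 / Real.sqrt |ν| : ℝ) : ℂ) =
      (Real.sqrt (a / d) : ℂ) * ((1 / Real.sqrt (|ν| * (a / d)) : ℝ) : ℂ) := by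
    rw [← Complex.ofReal_mul, Real.sqrt_mul (abs_nonneg ν)]
    congr 1
    have := (Real.sqrt_pos.mpr hr).ne'
    rw [one_div, one_div, mul_inv, mul_left_comm, mul_inv_cancel₀ this, mul_one]
  have harg : 4 * Real.pi * |ν| * (a * z.im / d) = 4 * Real.pi * (|ν| * (a / d)) * z.im := by ring
  rw [whittakerTerm, whittakerTerm, hre, him, habs, hsign, hexp, hsqrt, harg]
  ring

/-- Orthogonality of the additive characters modulo `d`. -/
lemma sum_exp_eq {d : ℕ} (hd : 0 < d) (t : ℤ) :
    ∑ b ∈ Finset.range d, Complex.exp (2 * Real.pi * Complex.I * (b * t / d)) =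
      if (d : ℤ) ∣ t then (d : ℂ) else 0 := by
  have hd0 : (d : ℂ) ≠ 0 := by exact_mod_cast hd.ne'
  have hb : ∀ b : ℕ, Complex.exp (2 * Real.pi * Complex.I * (b * t / d)) =
      Complex.exp (2 * Real.pi * Complex.I * (t / d)) ^ b := by
    intro b
    rw [← Complex.exp_nat_mul]
    congr 1
    ring
  simp_rw [hb]
  split_ifs with h
  · obtain ⟨q, rfl⟩ := h
    have : Complex.exp (2 * Real.pi * Complex.I * (((d * q : ℤ) : ℂ) / d)) = 1 := by
      rw [Complex.exp_eq_one_iff]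
      refine ⟨q, ?_⟩
      push_cast
      field_simp
    rw [this]
    simp
  · have hne : Complex.exp (2 * Real.pi * Complex.I * (t / d)) ≠ 1 := by
      intro h1
      obtain ⟨q, hq⟩ := Complex.exp_eq_one_iff.mp h1
      have hpi := Complex.two_pi_I_ne_zero
      rw [mul_comm (q : ℂ)] at hq
      have h2 := mul_left_cancel₀ hpi hq
      rw [div_eq_iff hd0] at h2
      exact h ⟨q, by rw [mul_comm]; exact_mod_cast h2⟩
    rw [geom_sum_eq hne, ← Complex.exp_nat_mul]
    have : Complex.exp (d * (2 * Real.pi * Complex.I * (t / d))) = 1 := by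
      rw [Complex.exp_eq_one_iff]
      exact ⟨t, by field_simp⟩
    rw [this, sub_self, zero_div]

/-- Modulo `12 / gcd(12, j)` the integer `d` is a unit, and units modulo a divisor of 12 have square
1. -/
lemma twelve_dvd_sq_sub_one {j a d m : ℤ} (h : 12 ∣ j * (m + 1)) (had : a * d = m) :
    12 ∣ j * (d ^ 2 - 1) := by
  subst had
  have h3 : ∀ j a d : ZMod 3, j * (a * d + 1) = 0 → j * (d ^ 2 - 1) = 0 := by decide
  have h4 : ∀ j a d : ZMod 4, j * (a * d + 1) = 0 → j * (d ^ 2 - 1) = 0 := by decide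
  rw [twelve_dvd_iff] at h ⊢
  push_cast at h ⊢
  exact ⟨h3 _ _ _ h.1, h4 _ _ _ h.2⟩

/-- The exponents differ by `3k(d - a - 2)`. If `ad ≡ -1` modulo 4, then `a` is odd and `d ≡ -a ≡ a
+ 2`; the factor `k` covers the remaining cases. -/
lemma chi_eq_of_mul_eq {k m : ℤ} {a d : ℕ} (h : 12 ∣ k * (m + 1)) (had : (a : ℤ) * d = m) :
    chi k d = (-1) ^ k * chi k a := by
  subst had
  rw [chi_eq, chi_eq, neg_one_zpow_eq, ← e12_add]
  apply e12_congr
  have h4 : ∀ k a d : ZMod 4, k * (a * d + 1) = 0 → k * (d - a - 2) = 0 := by decide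
  have h5 := h4 k a d (by exact_mod_cast ((twelve_dvd_iff _).mp h).2)
  have h6 : (4 : ℤ) ∣ k * ((d : ℤ) - a - 2) := by
    have h7 := (ZMod.intCast_zmod_eq_zero_iff_dvd (k * ((d : ℤ) - a - 2)) 4).mp
      (by push_cast; exact h5)
    exact_mod_cast h7
  obtain ⟨q, hq⟩ := h6
  exact ⟨q, by linear_combination 3 * hq⟩

/-- The contribution of one pair `ad = m` to the Fourier expansion of the Hecke sum. -/
lemma hasSum_inner {j k : ℤ} {R : ℝ} {m : ℤ} {a d : ℕ} (hm : 0 < m) (had : (a : ℤ) * d = m)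
    {q N : ℤ} (hq : j * ((d : ℤ) ^ 2 - 1) = 12 * q) (hN : j * (m + 1) = 12 * N)
    {f : ℍ → ℂ} {c : ℤ → ℂ}
    (hf : ∀ z, HasSum (fun n : ℤ => c n * whittakerTerm k R (n + j / 12) z) (f z)) (z : ℍ) :
    HasSum (fun n : ℤ => (if (a : ℤ) ∣ n - N then c (d * ((n - N) / a) + q) else 0) *
        whittakerTerm k R (n - j / 12) z)
      (((1 / Real.sqrt m : ℝ) : ℂ) * ∑ b ∈ Finset.range d, e12 j ^ (-((b : ℤ) * d)) *
        f (UpperHalfPlane.ofComplex ((a * z + b) / d))) := by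
  have ha : 0 < a := by
    rcases Nat.eq_zero_or_pos a with h | h
    · simp [h] at had
      omega
    · exact h
  have hd : 0 < d := by
    rcases Nat.eq_zero_or_pos d with h | h
    · simp [h] at had
      omega
    · exact h
  have haR : (0 : ℝ) < a := by exact_mod_cast ha
  have hdR : (0 : ℝ) < d := by exact_mod_cast hd
  have hdC : (d : ℂ) ≠ 0 := by exact_mod_cast hd.ne'
  have hmR : (a : ℝ) * d = m := by exact_mod_cast had
  have hqR : (j : ℝ) * ((d : ℝ) ^ 2 - 1) = 12 * q := by exact_mod_cast hq
  have hqC : (j : ℂ) * ((d : ℂ) ^ 2 - 1) = 12 * q := by exact_mod_cast hq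
  have hNR : (j : ℝ) * (m + 1) = 12 * N := by exact_mod_cast hN
  -- The normalisations of `T_m` and of the Whittaker terms cancel the length `d` of the character
  -- sum.
  have hnorm : ((1 / Real.sqrt m : ℝ) : ℂ) * Real.sqrt (a / d) * d = 1 := by
    have : 1 / Real.sqrt m * Real.sqrt (a / d) * d = 1 := by
      rw [← hmR, Real.sqrt_mul haR.le, Real.sqrt_div haR.le]
      have h1 := (Real.sqrt_pos.mpr haR).ne'
      have h2 := (Real.sqrt_pos.mpr hdR).ne'
      field_simp
      rw [Real.sq_sqrt hdR.le]
    exact_mod_cast this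
  -- Since `j - jd² = -12q`, the twist `ξ^{-bd}` makes the phase a `d`-th root of unity, and the sum
  -- over `b` selects `n ≡ q` modulo `d`.
  have hphase : ∀ (n : ℤ) (b : ℕ), e12 j ^ (-((b : ℤ) * d)) *
      Complex.exp (2 * Real.pi * Complex.I * (((n + j / 12 : ℝ) * b / d : ℝ) : ℂ)) =
        Complex.exp (2 * Real.pi * Complex.I * (b * ((n - q : ℤ) : ℂ) / d)) := by
    intro n b
    rw [← e12_mul, e12, ← Complex.exp_add]
    congr 1
    push_cast
    field_simp
    linear_combination (-(b : ℂ)) * hqC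
  have h1 : HasSum (fun n : ℤ => ((1 / Real.sqrt m : ℝ) : ℂ) * ∑ b ∈ Finset.range d,
      e12 j ^ (-((b : ℤ) * d)) * (c n * whittakerTerm k R (n + j / 12)
        (UpperHalfPlane.ofComplex ((a * z + b) / d))))
      (((1 / Real.sqrt m : ℝ) : ℂ) * ∑ b ∈ Finset.range d, e12 j ^ (-((b : ℤ) * d)) *
        f (UpperHalfPlane.ofComplex ((a * z + b) / d))) :=
    (hasSum_sum fun b _ => (hf _).mul_left _).mul_left _
  have h2 : ∀ n : ℤ, ((1 / Real.sqrt m : ℝ) : ℂ) * ∑ b ∈ Finset.range d,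
      e12 j ^ (-((b : ℤ) * d)) * (c n * whittakerTerm k R (n + j / 12)
        (UpperHalfPlane.ofComplex ((a * z + b) / d))) =
      if (d : ℤ) ∣ n - q then c n * whittakerTerm k R ((n + j / 12) * a / d) z else 0 := by
    intro n
    have h3 : ∀ b ∈ Finset.range d, e12 j ^ (-((b : ℤ) * d)) *
        (c n * whittakerTerm k R (n + j / 12) (UpperHalfPlane.ofComplex ((a * z + b) / d))) =
        Complex.exp (2 * Real.pi * Complex.I * (b * ((n - q : ℤ) : ℂ) / d)) *
          (Real.sqrt (a / d) * (c n * whittakerTerm k R ((n + j / 12) * a / d) z)) := by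
      intro b _
      rw [whittakerTerm_affine k R _ ha hd, ← hphase]
      ring
    rw [Finset.sum_congr rfl h3, ← Finset.sum_mul, sum_exp_eq hd]
    split_ifs
    · linear_combination (c n * whittakerTerm k R ((n + j / 12) * a / d) z) * hnorm
    · ring
  simp_rw [h2] at h1
  have hinj : Function.Injective (fun l : ℤ => d * l + q) := by
    intro x y h
    have h' : (d : ℤ) * x = d * y := by simpa using h
    exact mul_left_cancel₀ (by exact_mod_cast hd.ne') h'
  have hinj' : Function.Injective (fun l : ℤ => a * l + N) := by
    intro x y h
    have h' : (a : ℤ) * x = a * y := by simpa using h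
    exact mul_left_cancel₀ (by exact_mod_cast ha.ne') h'
  -- Both series are supported on progressions and are matched through one parameter `l`: the old
  -- index is `dl + q`, the new one `al + N`.
  rw [← hinj.hasSum_iff] at h1
  · rw [← hinj'.hasSum_iff]
    · refine h1.congr_fun ?_
      intro l
      have hl : ((a : ℤ) * l + N - N) / a = l := by
        rw [add_sub_cancel_right]
        exact Int.mul_ediv_cancel_left _ (by exact_mod_cast ha.ne')
      have hν : (((d * l + q : ℤ) : ℝ) + j / 12) * a / d = ((a * l + N : ℤ) : ℝ) - j / 12 := by
        push_cast
        field_simp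
        linear_combination (-(a : ℝ)) * hqR + (d : ℝ) * hNR + (j * d : ℝ) * hmR
      simp only [Function.comp_apply]
      rw [if_pos (by simp), if_pos (by simp), hl, hν]
    · intro n hn
      rw [if_neg, zero_mul]
      rintro ⟨l, hl⟩
      exact hn ⟨l, by simp only; omega⟩
  · intro n hn
    rw [if_neg]
    rintro ⟨l, hl⟩
    exact hn ⟨l, by simp only; omega⟩

lemma coeffAt_intCast (c : ℤ → ℂ) (n : ℤ) : coeffAt c (n : ℚ) = c n := by
  simp [coeffAt]

lemma sum_antidiagonal_eq {j k : ℤ} {m : ℕ} (hj : j = k ∨ j = -k) (hm : 0 < m)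
    (hkm : 12 ∣ k * ((m : ℤ) + 1)) (c : ℤ → ℂ) (n : ℤ) :
    ∑ p ∈ m.divisorsAntidiagonal, chi k p.2 *
      (if (p.1 : ℤ) ∣ n - j * (m + 1) / 12 then
        c (p.2 * ((n - j * (m + 1) / 12) / p.1) + j * ((p.2 : ℤ) ^ 2 - 1) / 12) else 0) =
    (-1) ^ k * ∑ a ∈ (Int.gcd m (n - j * (m + 1) / 12)).divisors,
      chi k a * coeffAt c ((m * n : ℚ) / a ^ 2 - j * (m + a ^ 2) / (12 * a ^ 2)) := by
  have hjm := dvd_mul_succ hj hkm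
  obtain ⟨N, hN⟩ := hjm
  have hNdiv : j * ((m : ℤ) + 1) / 12 = N := by omega
  rw [hNdiv, Nat.sum_divisorsAntidiagonal (f := fun a d => chi k d *
    (if (a : ℤ) ∣ n - N then c (d * ((n - N) / a) + j * ((d : ℤ) ^ 2 - 1) / 12) else 0)),
    Finset.mul_sum]
  symm
  apply Finset.sum_subset_zero_on_sdiff
  · exact Nat.divisors_subset_of_dvd hm.ne' 
      (Int.natCast_dvd_natCast.mp (Int.gcd_dvd_left ..))
  · intro a ha
    rw [Finset.mem_sdiff, Nat.mem_divisors, Nat.mem_divisors] at ha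
    rw [if_neg, mul_zero]
    intro h
    refine ha.2 ⟨?_, ?_⟩
    · exact Int.dvd_gcd (by exact_mod_cast ha.1.1) h
    · intro h0
      have := (Int.gcd_eq_zero_iff.mp h0).1
      omega
  · intro a ha
    rw [Nat.mem_divisors] at ha
    have ham : a ∣ m := by
      exact_mod_cast (Int.natCast_dvd_natCast.mpr ha.1).trans (Int.gcd_dvd_left ..)
    have han : (a : ℤ) ∣ n - N := (Int.natCast_dvd_natCast.mpr ha.1).trans (Int.gcd_dvd_right ..)
    rw [if_pos han]
    have had : (a : ℤ) * ((m / a : ℕ) : ℤ) = m := by exact_mod_cast Nat.mul_div_cancel' ham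
    obtain ⟨q, hq⟩ := twelve_dvd_sq_sub_one (dvd_mul_succ hj hkm) had
    have ha0 : 0 < a := Nat.pos_of_dvd_of_pos ham hm
    obtain ⟨l, hl⟩ := han
    have hdiv : j * (((m / a : ℕ) : ℤ) ^ 2 - 1) / 12 = q := by omega
    have hl' : (n - N) / (a : ℤ) = l := by
      rw [hl]
      exact Int.mul_ediv_cancel_left _ (by exact_mod_cast ha0.ne')
    -- For each `a` in the sum the rational argument equals the integer `dl + q`, so the zero
    -- convention of `coeffAt` never acts here.
    rw [hdiv, hl', chi_eq_of_mul_eq hkm had, ← mul_assoc, ← coeffAt_intCast c]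
    congr 2
    have haQ : (a : ℚ) ≠ 0 := by exact_mod_cast ha0.ne'
    generalize m / a = d at *
    have e1 : (a : ℚ) * d = m := by exact_mod_cast had
    have e2 : (j : ℚ) * ((d : ℚ) ^ 2 - 1) = 12 * q := by exact_mod_cast hq
    have e3 : (n : ℚ) - N = a * l := by exact_mod_cast hl
    have e4 : (j : ℚ) * (m + 1) = 12 * N := by exact_mod_cast hN
    push_cast
    rw [← e1] at e4 ⊢
    field_simp
    linear_combination (12 * (d : ℚ)) * e3 + (a : ℚ) * e2 - (d : ℚ) * e4

lemma hasSum_heckeSum {j k : ℤ} {R : ℝ} {m : ℕ} (hj : j = k ∨ j = -k) (hm : 0 < m)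
    (hkm : 12 ∣ k * ((m : ℤ) + 1)) {f : ℍ → ℂ} {c : ℤ → ℂ}
    (hf : ∀ z, HasSum (fun n : ℤ => c n * whittakerTerm k R (n + j / 12) z) (f z)) (z : ℍ) :
    HasSum (fun n : ℤ => ((-1) ^ k * ∑ a ∈ (Int.gcd m (n - j * (m + 1) / 12)).divisors,
      chi k a * coeffAt c ((m * n : ℚ) / a ^ 2 - j * (m + a ^ 2) / (12 * a ^ 2))) *
        whittakerTerm k R (n - j / 12) z) (heckeSum (e12 j) k m f z) := by
  have hjm := dvd_mul_succ hj hkm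
  have h := hasSum_sum (s := m.divisorsAntidiagonal) (fun p hp =>
    (hasSum_inner (j := j) (k := k) (R := R) (m := m) (a := p.1) (d := p.2) (by exact_mod_cast hm)
      (by exact_mod_cast (Nat.mem_divisorsAntidiagonal.mp hp).1)
      (q := j * ((p.2 : ℤ) ^ 2 - 1) / 12) (N := j * (m + 1) / 12)
      (Int.mul_ediv_cancel' (twelve_dvd_sq_sub_one hjm (a := p.1)
        (by exact_mod_cast (Nat.mem_divisorsAntidiagonal.mp hp).1))).symm
      (Int.mul_ediv_cancel' hjm).symm hf z).mul_left (chi k p.2))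
  convert! h using 1
  · ext n
    rw [← sum_antidiagonal_eq hj hm hkm, Finset.sum_mul]
    refine Finset.sum_congr rfl fun p _ => ?_
    ring
  · change ((1 / Real.sqrt m : ℝ) : ℂ) * _ = _
    rw [Finset.mul_sum]
    refine Finset.sum_congr rfl fun p _ => ?_
    push_cast
    ring

lemma conj_xi (k : ℤ) : conj (xi k) = e12 (-k) := by
  rw [xi_eq, conj_e12]

lemma twelve_dvd_of_modEq {k : ℤ} {m : ℕ} (h : k * m ≡ -k [ZMOD 12]) :
    12 ∣ k * ((m : ℤ) + 1) := by
  have := h.symm.dvd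
  rwa [sub_neg_eq_add, ← mul_add_one] at this

end MaassHecke

end

/-! ### The main theorem: specialisation to `j = k` and `j = -k`. -/

theorem mainTheorem3 (k : ℤ) (hk : ¬ (12 : ℤ) ∣ k) (R : ℝ) (hR : R ≠ 0)
    (m : ℕ) (hm : 0 < m) (hkm : k * m ≡ -k [ZMOD 12]) :
    Set.MapsTo (MaassHecke.heckeT k m)
      (MaassHecke.maassSpace (MaassHecke.mult k) k R)
      (MaassHecke.maassSpace (MaassHecke.multConj k) k R) ∧
    Set.MapsTo (MaassHecke.heckeTConj k m)
      (MaassHecke.maassSpace (MaassHecke.multConj k) k R)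
      (MaassHecke.maassSpace (MaassHecke.mult k) k R) ∧
    (∀ f ∈ MaassHecke.maassSpace (MaassHecke.mult k) k R, ∀ c : ℤ → ℂ,
      (∀ z : UpperHalfPlane, HasSum (fun n : ℤ => c n * MaassHecke.calW n k R z) (f z)) →
      ∀ z : UpperHalfPlane,
        HasSum (fun n : ℤ => MaassHecke.coeffT k m c n * MaassHecke.calWstar n k R z)
          (MaassHecke.heckeT k m f z)) ∧
    (∀ g ∈ MaassHecke.maassSpace (MaassHecke.multConj k) k R, ∀ a : ℤ → ℂ,
      (∀ z : UpperHalfPlane, HasSum (fun n : ℤ => a n * MaassHecke.calWstar n k R z) (g z)) →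
      ∀ z : UpperHalfPlane,
        HasSum (fun n : ℤ => MaassHecke.coeffTConj k m a n * MaassHecke.calW n k R z)
          (MaassHecke.heckeTConj k m g z)) := by
  have hdvd := MaassHecke.twelve_dvd_of_modEq hkm
  have hv : MaassHecke.mult k = fun A => MaassHecke.matChar k A.1 :=
    funext (MaassHecke.mult_eq k)
  have hv' : MaassHecke.multConj k = fun A => MaassHecke.matChar (-k) A.1 :=
    funext (MaassHecke.multConj_eq k)
  refine ⟨fun f hf => ?_, fun f hf => ?_, fun f _ c hc z => ?_, fun g _ c hc z => ?_⟩
  · rw [MaassHecke.maassSpace, Set.mem_ofPred_eq, hv] at hf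
    rw [MaassHecke.maassSpace, Set.mem_ofPred_eq, hv', MaassHecke.heckeT, MaassHecke.xi_eq]
    exact MaassHecke.isMaassWaveform_heckeSum (Or.inl rfl) hm hdvd hf
  · rw [MaassHecke.maassSpace, Set.mem_ofPred_eq, hv'] at hf
    rw [MaassHecke.maassSpace, Set.mem_ofPred_eq, hv, MaassHecke.heckeTConj, MaassHecke.conj_xi]
    have h := MaassHecke.isMaassWaveform_heckeSum (Or.inr rfl) hm hdvd hf
    rwa [neg_neg] at h
  · rw [MaassHecke.heckeT, MaassHecke.xi_eq]
    exact MaassHecke.hasSum_heckeSum (Or.inl rfl) hm hdvd hc z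
  · rw [MaassHecke.heckeTConj, MaassHecke.conj_xi]
    have h := MaassHecke.hasSum_heckeSum (R := R) (j := -k) (Or.inr rfl) hm hdvd
      (f := g) (c := c) (fun z => by
        convert! hc z using 3 with n
        rw [MaassHecke.calWstar]
        push_cast
        ring_nf) z
    convert! h using 3 with n
    -- Integer division commutes with negation here because `k(m + 1)` is divisible by 12.
    · rw [MaassHecke.coeffTConj, neg_mul, Int.neg_ediv_of_dvd hdvd, sub_neg_eq_add]
      congr 1
      refine Finset.sum_congr rfl fun a _ => ?_
      congr 2
      push_cast
      ring
    · rw [MaassHecke.calW]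
      push_cast
      ring_nf
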